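/- Let $\beta>1$ be real, let $\mathfrak d\ni 0$ be a finite set of nonnegative real numbers with at least two elements, put $D=\log_\beta|\mathfrak d|$, and let $\mathfrak b=(b_k)_{k\ge0}$ be a sequence of positive real numbers. For real $\lambda$ let $r_{\mathfrak b,\mathfrak d}(\lambda)$ be the number of sequences $(\delta_k)_{k\ge 0}$ in $\mathfrak d$ with $\sum_{k\ge0}\delta_kb_k=\lambda$, and let $$\zeta_{\mathfrak b,\mathfrak d}(s)=\sum_{\lambda>0}r_{\mathfrak b,\mathfrak d}(\lambda)\lambda^{-s}.$$ Let $S_{\beta,\mathfrak d}(x)$ be the number of sequences $(\delta_k)_{k\ge 0}$ in $\mathfrak d$ with $\sum_{k\ge0}\delta_k\beta^k\le x$, let $$\Psi_{\beta,\mathfrak d}(x)=\frac{S_{\beta,\mathfrak d}(\beta^x)}{|\mathfrak d|^{x}}-\frac1{|\mathfrak d|}\sum_{h\ge0}\frac1{|\mathfrak d|^{h+x}}\sum_{\delta\in\mathfrak d}\bigl(S_{\beta,\mathfrak d}(\beta^{h+x})-S_{\beta,\mathfrak d}(\beta^{h+x}-\beta^{-1}\delta)\bigr),\qquad \widehat\Psi(k)=\int_0^1\Psi_{\beta,\mathfrak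 d}(x)e^{-2\pi ikx}\,dx,$$ and for $j\in\mathbb N_0$ let $$c_{\beta,\mathfrak d}(j)=\sum_{\substack{\ell_1,\dots,\ell_j\ge0\\ \ell_1+2\ell_2+\cdots+j\ell_j=j}}\ \prod_{h=1}^{j}\frac1{\ell_h!}\left(\frac{[y^h]L(y)}{1-\beta^h}\right)^{\ell_h},\qquad L(y)=\log\sum_{\delta\in\mathfrak d}e^{-\delta y},$$ where $[y^h]L(y)$ is a Maclaurin coefficient; put $c_{\beta,\mathfrak d}(u)=0$ for real $u\notin\mathbb N_0$. If $b_k=\beta^k+O(\beta^{(1-\gamma)k})$ with a fixed $\gamma\in(0,1]$, let $U=\{s:\operatorname{Re}s>D-\gamma\}$; if $b_k=\beta^k$ for all $k$, one may also take $U=\mathbb C$. Then the series $\zeta_{\mathfrak b,\mathfrak d}(s)$ converges absolutely for $\operatorname{Re}s>D$ and continues to a meromorphic function on $U$. In $U$ it is holomorphic except for at most simple poles at those of the points $$p(j,k)=D-j-\frac{2\pi ik}{\log\beta}\qquad(j\in\mathbb N_0,\ k\in\mathbb Z)$$ that lie in $U$, and the residue at $p(j,k)\in U$ (zero if the singularity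 is removable) is $$\frac{\Gamma\bigl(1+D-\frac{2\pi ik}{\log\beta}\bigr)}{\Gamma(p(j,k))}\,c_{\beta,\mathfrak d}(j)\,\widehat\Psi(-k),$$ where $1/\Gamma(-m)=0$ for $m\in\mathbb N_0$. The continuation is holomorphic at each $-n\in U$ with $n\in\mathbb N_0$, and $$\zeta_{\mathfrak b,\mathfrak d}(-n)=(-1)^n\,n!\,c_{\beta,\mathfrak d}(n+D)\,\Gamma(1+D)\,\widehat\Psi(0)-\mathbf 1_{n=0}.$$ -/

import Mathlib

open Filter Topology Asymptotics

noncomputable section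

namespace NumSys

/-- `Represents b d δ x`: `δ = (δ₀, δ₁, …)` is a digit sequence with values in `d` whose series
`∑ δ_k b_k` converges to `x`. -/
def Represents (b : ℕ → ℝ) (d : Finset ℝ) (δ : ℕ → ℝ) (x : ℝ) : Prop :=
  (∀ k, δ k ∈ d) ∧ HasSum (fun k => δ k * b k) x

/-- The representation function `r_{b,d}(x)`: the number of representations of `x`. -/
def repCount (b : ℕ → ℝ) (d : Finset ℝ) (x : ℝ) : ℕ :=
  Set.ncard {δ : ℕ → ℝ | Represents b d δ x}

/-- The counting function `S_{b,d}(x)`: the number of digit sequences representing a number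
that is at most `x`. -/
def countFn (b : ℕ → ℝ) (d : Finset ℝ) (x : ℝ) : ℕ :=
  Set.ncard {δ : ℕ → ℝ | ∃ y ≤ x, Represents b d δ y}

/-- The counting function `S_{β,d}` for the base `(β^k)`. -/
def countPow (β : ℝ) (d : Finset ℝ) (x : ℝ) : ℝ :=
  (countFn (fun k => β ^ k) d x : ℝ)

/-- The exponent `log_β |d|`. -/
def dimExp (β : ℝ) (d : Finset ℝ) : ℝ := Real.logb β (d.card : ℝ)

/-- The relative density function `Ψ_{β,d}`. -/
def relDensity (β : ℝ) (d : Finset ℝ) (x : ℝ) : ℝ :=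
  countPow β d (β ^ x) / (d.card : ℝ) ^ x
    - (d.card : ℝ)⁻¹ * ∑' h : ℕ, 1 / (d.card : ℝ) ^ ((h : ℝ) + x) *
        ∑ δ ∈ d, (countPow β d (β ^ ((h : ℝ) + x))
          - countPow β d (β ^ ((h : ℝ) + x) - β⁻¹ * δ))

/-- The `k`-th Fourier coefficient of the `1`-periodic function `Ψ_{β,d}`. -/
def densityFourier (β : ℝ) (d : Finset ℝ) (k : ℤ) : ℂ :=
  ∫ x in (0 : ℝ)..1, (relDensity β d x : ℂ) *
    Complex.exp (-(2 * Real.pi * Complex.I * k * x))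

/-- `L_d(y) = log ∑_{δ ∈ d} e^{-δ y}`. -/
def logGen (d : Finset ℝ) (y : ℝ) : ℝ := Real.log (∑ δ ∈ d, Real.exp (-δ * y))

/-- The Maclaurin coefficient `[y^h] L_d(y)`. -/
def logGenCoeff (d : Finset ℝ) (h : ℕ) : ℝ :=
  iteratedDeriv h (logGen d) 0 / (h.factorial : ℝ)

/-- The constant `c_{β,d}(j)`, a sum over all `(ℓ₁, …, ℓ_j)` of natural numbers with
`1·ℓ₁ + 2·ℓ₂ + ⋯ + j·ℓ_j = j` (so that every `ℓ_h` is at most `j`). The index `i : Fin j`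
stands for `h = i + 1`. -/
def coeffC (β : ℝ) (d : Finset ℝ) (j : ℕ) : ℝ :=
  ∑ l ∈ (Fintype.piFinset (fun _ : Fin j => Finset.range (j + 1))).filter
      (fun l => ∑ i : Fin j, ((i : ℕ) + 1) * l i = j),
    ∏ i : Fin j, 1 / ((l i).factorial : ℝ) *
      (logGenCoeff d ((i : ℕ) + 1) / (1 - β ^ ((i : ℕ) + 1))) ^ (l i)

open Classical in
/-- `c_{β,d}(u)` for real `u`, equal to `0` unless `u` is a nonnegative integer. -/
def coeffCReal (β : ℝ) (d : Finset ℝ) (u : ℝ) : ℝ :=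
  if u = (⌊u⌋₊ : ℝ) then coeffC β d ⌊u⌋₊ else 0

/-- The term `r_{b,d}(x) / x^s` of the zeta function at `x > 0`. -/
def zetaTerm (b : ℕ → ℝ) (d : Finset ℝ) (s : ℂ) (x : {x : ℝ // 0 < x}) : ℂ :=
  (repCount b d x : ℂ) / ((x : ℝ) : ℂ) ^ s

/-- The zeta function `ζ_{b,d}(s) = ∑_{x > 0} r_{b,d}(x) / x^s` (where the series converges). -/
def zeta (b : ℕ → ℝ) (d : Finset ℝ) (s : ℂ) : ℂ := ∑' x, zetaTerm b d s x

/-- The points `log_β |d| - j - 2πik / log β`. -/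
def polePt (β : ℝ) (d : Finset ℝ) (j : ℕ) (k : ℤ) : ℂ :=
  (dimExp β d : ℂ) - j - 2 * Real.pi * k * Complex.I / (Real.log β : ℂ)

/-- The residue at `p = log_β |d| - j - 2πik / log β`, namely
`Γ(1 + log_β |d| - 2πik / log β) / Γ(p) · c(j) · Ψ̂(-k)`. At `p = 0, -1, -2, …` the quotient is `0`,
in agreement with the entire function `1 / Γ`, since there `Complex.Gamma p = 0`. -/
def poleRes (β : ℝ) (d : Finset ℝ) (j : ℕ) (k : ℤ) : ℂ :=
  Complex.Gamma (1 + (dimExp β d : ℂ) - 2 * Real.pi * k * Complex.I / (Real.log β : ℂ)) /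
      Complex.Gamma (polePt β d j k) * (coeffC β d j : ℂ) * densityFourier β d (-k)

/-- `F` is a meromorphic continuation of `ζ_{b,d}` to the region `U`, with the asserted
singularities, residues and values. -/
structure IsZetaContinuation (β : ℝ) (b : ℕ → ℝ) (d : Finset ℝ) (U : Set ℂ) (F : ℂ → ℂ) :
    Prop where
  meromorphic : MeromorphicOn F U
  /-- The series converges absolutely to `F` for `Re s > log_β |d|`. -/
  eq_zeta : ∀ s : ℂ, dimExp β d < s.re → Summable (zetaTerm b d s) ∧ F s = zeta b d s
  /-- There are no singularities away from the points `polePt β d j k`. -/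
  analytic : ∀ s ∈ U, (∀ (j : ℕ) (k : ℤ), s ≠ polePt β d j k) → AnalyticAt ℂ F s
  /-- Every pole is simple. -/
  simple : ∀ s ∈ U, (-1 : ℤ) ≤ meromorphicOrderAt F s
  /-- The residues; a zero residue means that the singularity is removable. -/
  residue : ∀ (j : ℕ) (k : ℤ), polePt β d j k ∈ U →
    Tendsto (fun s => (s - polePt β d j k) * F s) (𝓝[≠] (polePt β d j k))
      (𝓝 (poleRes β d j k))
  /-- `F` is holomorphic at the nonpositive integers of `U`, with the stated values. -/
  value : ∀ n : ℕ, (-(n : ℂ)) ∈ U → AnalyticAt ℂ F (-(n : ℂ)) ∧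
    F (-(n : ℂ)) = (-1) ^ n * (n.factorial : ℂ) * (coeffCReal β d (n + dimExp β d) : ℂ) *
      Complex.Gamma (1 + (dimExp β d : ℂ)) * densityFourier β d 0 - (if n = 0 then 1 else 0)

end NumSys

end

/-! A convergent representation has only finitely many nonzero digits, so everything becomes a sum
over words `w` with value `N(w)`. There are at most `|d|^n` words of length at most `n`, and a
nonzero word of length `n` has value at least a constant times `β^n = |d|^(n/D)`; this gives
absolute convergence for `Re s > D`.

For `b_k = β^k`, let `G(y) = ∑ e^{-N(w) y}` and `g(y) = ∑ e^{-δ y}`. Splitting off the first digit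
gives `G(y) = g(y) G(βy)` (`wordGen_eq_mul`). Near `0` the function `E(y) = exp (∑ [y^h]L / (1 -
β^h) y^h)` satisfies `|d| E(y) = g(y) E(βy)`, and its Taylor coefficients are the `c(j)`
(`exists_local_factor`). Hence `G / E` only picks up the factor `|d|` under `y ↦ y / β`. Letting `n
→ ∞` in `G(y / β^n) / |d|^n`, with `G` written as a Laplace transform of the counting function,
identifies `G / E` as `y^{-D} φ(y)`, where `φ` is the multiplicatively `β`-periodic smoothing of `Ψ`
(`tendsto_wordGen`, `exists_wordGen_expansion`).

The Mellin transform of `G - 1` is `Γ(s) ζ(s)`. Subtracting `c(j) y^{j-D} φ(y)` on `(0, 1]` for `j <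
J` leaves a remainder whose transform is holomorphic for `Re s > D - J`. Each subtracted term has,
by periodicity, the transform of a single period of `φ`, which is entire, divided by `1 - β^{-w}`
with `w = s + j - D` (`mellin_densityCut`). The zeros of this denominator are the points `p(j,k)`,
and the transform of a period there is `log β` times a Gamma value times `Ψ̂(-k)`
(`mellin_densityPeriod_imagPt`). Dividing by `Γ` gives the residues, and the simple zeros of `1/Γ`
at `-n` give the values there. The empty word accounts for the term `-1/Γ(s+1)`, hence for `-1` at
`s = 0`.

For a perturbed base, the termwise difference of the two zeta series converges locally uniformly for
`Re s > D - γ` and vanishes at `0` (`analyticAt_zetaDiff`). It therefore changes no residue, and `0`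
is the only possible nonpositive integer in that half-plane. -/

noncomputable section

namespace NumSys

/-! ### Words, their values, and the zeta series as a sum over words. -/

/-- The conditions on the digit set `d`. -/
structure IsDigitSet (d : Finset ℝ) : Prop where
  zero_mem : (0 : ℝ) ∈ d
  nonneg : ∀ δ ∈ d, 0 ≤ δ
  two_le : 2 ≤ d.card

/-- Digit sequences with finitely many nonzero digits. -/
abbrev Word (d : Finset ℝ) : Type :=
  {w : ℕ → ℝ // (∀ k, w k ∈ d) ∧ (Function.support w).Finite}

namespace Word

variable {d : Finset ℝ}

/-- The number `∑ w_k b_k` represented by a word. -/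
def val (b : ℕ → ℝ) (w : Word d) : ℝ := ∑' k, w.1 k * b k

/-- The length of a word, not counting trailing zeros. -/
def deg (w : Word d) : ℕ := w.2.2.toFinset.sup (fun k => k + 1)

lemma eq_zero_of_deg_le (w : Word d) {k : ℕ} (hk : w.deg ≤ k) : w.1 k = 0 := by
  by_contra h
  have h1 : k ∈ w.2.2.toFinset := by simpa using h
  have h2 : k + 1 ≤ w.deg := Finset.le_sup (f := fun k => k + 1) h1
  omega

lemma deg_le_iff (w : Word d) {n : ℕ} : w.deg ≤ n ↔ ∀ k, n ≤ k → w.1 k = 0 := by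
  refine ⟨fun h k hk => w.eq_zero_of_deg_le (h.trans hk), fun h => ?_⟩
  refine Finset.sup_le fun k hk => ?_
  by_contra hlt
  exact (by simpa using hk : w.1 k ≠ 0) (h k (by omega))

lemma top_digit_ne_zero (w : Word d) (h : w.deg ≠ 0) : w.1 (w.deg - 1) ≠ 0 := by
  intro h0
  have : w.deg ≤ w.deg - 1 := by
    rw [deg_le_iff]
    intro k hk
    rcases hk.eq_or_lt with h1 | h1
    · rw [← h1]; exact h0
    · exact w.eq_zero_of_deg_le (by omega)
  omega

/-- The word without nonzero digits. -/
def zero (hd : IsDigitSet d) : Word d := ⟨fun _ => 0, fun _ => hd.zero_mem, by simp⟩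

lemma deg_eq_zero_iff (hd : IsDigitSet d) (w : Word d) : w.deg = 0 ↔ w = zero hd := by
  rw [← Nat.le_zero, deg_le_iff]
  constructor
  · intro h
    exact Subtype.ext (funext fun k => h k (Nat.zero_le _))
  · rintro rfl k _
    rfl

lemma val_hasSum (b : ℕ → ℝ) (w : Word d) : HasSum (fun k => w.1 k * b k) (w.val b) := by
  have : Summable (fun k => w.1 k * b k) :=
    summable_of_hasFiniteSupport (w.2.2.subset fun k hk => left_ne_zero_of_mul hk)
  exact this.hasSum

lemma val_eq_sum (b : ℕ → ℝ) (w : Word d) {n : ℕ} (hn : w.deg ≤ n) :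
    w.val b = ∑ k ∈ Finset.range n, w.1 k * b k :=
  tsum_eq_sum fun k hk => by
    rw [w.eq_zero_of_deg_le (hn.trans (by simpa using hk)), zero_mul]

@[simp] lemma val_zero (hd : IsDigitSet d) (b : ℕ → ℝ) : (zero hd).val b = 0 := by
  simp [val, zero]

lemma card_le_of_deg_le (s : Finset (Word d)) (n : ℕ) (hs : ∀ w ∈ s, w.deg ≤ n) :
    s.card ≤ d.card ^ n := by
  let f : Word d → (Fin n → d) := fun w i => ⟨w.1 i, w.2.1 i⟩
  have hf : Set.InjOn f s := by
    intro w hw v hv h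
    refine Subtype.ext (funext fun k => ?_)
    by_cases hk : k < n
    · have := congrFun h ⟨k, hk⟩
      simpa [f] using this
    · rw [w.eq_zero_of_deg_le ((hs w hw).trans (not_lt.mp hk)),
        v.eq_zero_of_deg_le ((hs v hv).trans (not_lt.mp hk))]
  have := Finset.card_le_card_of_injOn (t := Finset.univ) f (fun _ _ => Finset.mem_univ _) hf
  simpa using this

lemma finite_deg_le (n : ℕ) : {w : Word d | w.deg ≤ n}.Finite := by
  by_contra h
  obtain ⟨t, ht, hc⟩ := Set.Infinite.exists_subset_card_eq h (d.card ^ n + 1)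
  have := card_le_of_deg_le t n (fun w hw => ht hw)
  omega

instance : Countable (Word d) := by
  have : (Set.univ : Set (Word d)) = ⋃ n : ℕ, {w : Word d | w.deg ≤ n} := by
    ext w; simp only [Set.mem_univ, Set.mem_iUnion, true_iff]; exact ⟨w.deg, le_refl w.deg⟩
  rw [← Set.countable_univ_iff, this]
  exact Set.countable_iUnion fun n => (finite_deg_le n).countable

/-- Group the words by degree: at most `|d|^n` of them have degree exactly `n`. -/
lemma summable_of_deg {g : ℕ → ℝ} (hg : ∀ n, 0 ≤ g n)
    (hs : Summable fun n => (d.card : ℝ) ^ n * g n) : Summable fun w : Word d => g w.deg := by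
  classical
  refine summable_of_sum_le (c := ∑' n, (d.card : ℝ) ^ n * g n) (fun w => hg _) fun u => ?_
  rw [← Finset.sum_fiberwise_of_maps_to (t := u.image deg) (g := deg)
    (fun w hw => Finset.mem_image_of_mem _ hw)]
  refine le_trans (Finset.sum_le_sum fun n _ => ?_)
    (hs.sum_le_tsum (u.image deg) fun n _ => mul_nonneg (by positivity) (hg n))
  rw [Finset.sum_congr rfl (g := fun _ => g n) (fun w hw => by rw [(Finset.mem_filter.mp hw).2]),
    Finset.sum_const, nsmul_eq_mul]
  refine mul_le_mul_of_nonneg_right ?_ (hg n)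
  exact_mod_cast card_le_of_deg_le _ n fun w hw => le_of_eq (Finset.mem_filter.mp hw).2

lemma val_nonneg (hd : IsDigitSet d) {b : ℕ → ℝ} (hb : ∀ k, 0 ≤ b k) (w : Word d) :
    0 ≤ w.val b :=
  tsum_nonneg fun k => mul_nonneg (hd.nonneg _ (w.2.1 k)) (hb k)

end Word

lemma IsDigitSet.one_lt_card {d : Finset ℝ} (hd : IsDigitSet d) : (1 : ℝ) < d.card := by
  have := hd.two_le
  exact_mod_cast this

lemma IsDigitSet.card_pos {d : Finset ℝ} (hd : IsDigitSet d) : (0 : ℝ) < d.card :=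
  zero_lt_one.trans hd.one_lt_card

/-- The smallest nonzero digit is positive. -/
lemma IsDigitSet.exists_gap {d : Finset ℝ} (hd : IsDigitSet d) :
    ∃ a : ℝ, 0 < a ∧ ∀ δ ∈ d, δ ≠ 0 → a ≤ δ := by
  have hne : (d.erase 0).Nonempty := by
    rw [← Finset.card_pos, Finset.card_erase_of_mem hd.zero_mem]
    have := hd.two_le
    omega
  obtain ⟨a, ha, hmin⟩ := (d.erase 0).exists_min_image id hne
  rw [Finset.mem_erase] at ha
  exact ⟨a, lt_of_le_of_ne (hd.nonneg a ha.2) (Ne.symm ha.1), fun δ hδ h0 =>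
    hmin δ (Finset.mem_erase.mpr ⟨h0, hδ⟩)⟩

lemma IsDigitSet.exists_bound {d : Finset ℝ} (hd : IsDigitSet d) :
    ∃ M : ℝ, 0 < M ∧ ∀ δ ∈ d, δ ≤ M := by
  obtain ⟨a, -, hmax⟩ := d.exists_max_image id ⟨0, hd.zero_mem⟩
  exact ⟨max a 1, by positivity, fun δ hδ => (hmax δ hδ).trans (le_max_left _ _)⟩

lemma dimExp_pos {β : ℝ} (hβ : 1 < β) {d : Finset ℝ} (hd : IsDigitSet d) : 0 < dimExp β d :=
  Real.logb_pos hβ hd.one_lt_card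

lemma rpow_dimExp {β : ℝ} (hβ : 1 < β) {d : Finset ℝ} (hd : IsDigitSet d) :
    β ^ dimExp β d = d.card :=
  Real.rpow_logb (by linarith) hβ.ne' hd.card_pos

namespace Word

variable {d : Finset ℝ}

lemma le_val_of_gap (hd : IsDigitSet d) {a : ℝ} (ha : ∀ δ ∈ d, δ ≠ 0 → a ≤ δ) {b : ℕ → ℝ}
    (hb : ∀ k, 0 ≤ b k) (w : Word d) (hw : w.deg ≠ 0) : a * b (w.deg - 1) ≤ w.val b := by
  refine le_trans (mul_le_mul_of_nonneg_right
    (ha _ (w.2.1 _) (w.top_digit_ne_zero hw)) (hb _)) ?_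
  exact (val_hasSum b w).summable.le_tsum (w.deg - 1)
    fun k _ => mul_nonneg (hd.nonneg _ (w.2.1 k)) (hb k)

end Word

/-- The nonzero words. -/
abbrev NzWord (d : Finset ℝ) : Type := {w : Word d // w.deg ≠ 0}

/-- There is `c > 0` with `c β ^ deg w ≤ val w` for all nonzero words. -/
lemma exists_le_val {β : ℝ} (hβ : 1 < β) {d : Finset ℝ} (hd : IsDigitSet d) {b : ℕ → ℝ}
    {c₀ : ℝ} (hc₀ : 0 < c₀) (hb : ∀ k, c₀ * β ^ k ≤ b k) :
    ∃ c : ℝ, 0 < c ∧ ∀ w : NzWord d, c * β ^ w.1.deg ≤ w.1.val b := by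
  obtain ⟨a, ha, hgap⟩ := hd.exists_gap
  have hβ0 : 0 < β := by linarith
  refine ⟨a * c₀ / β, by positivity, fun w => ?_⟩
  have hb0 : ∀ k, 0 ≤ b k := fun k => le_trans (by positivity) (hb k)
  refine le_trans ?_ (w.1.le_val_of_gap hd hgap hb0 w.2)
  obtain ⟨n, hn⟩ := Nat.exists_eq_succ_of_ne_zero w.2
  rw [hn, Nat.succ_eq_add_one, Nat.add_sub_cancel, pow_succ]
  calc a * c₀ / β * (β ^ n * β) = a * (c₀ * β ^ n) := by field_simp
    _ ≤ _ := mul_le_mul_of_nonneg_left (hb n) ha.le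

/-- As `|d| = β^D`, this is a geometric series with ratio `β^(D - σ)`. -/
lemma summable_pow_mul_rpow {β : ℝ} (hβ : 1 < β) {d : Finset ℝ} (hd : IsDigitSet d) {σ : ℝ}
    (hσ : dimExp β d < σ) : Summable fun n : ℕ => (d.card : ℝ) ^ n * (β ^ n) ^ (-σ) := by
  have hβ0 : 0 < β := by linarith
  have : (fun n : ℕ => (d.card : ℝ) ^ n * (β ^ n) ^ (-σ)) = fun n : ℕ => (β ^ (dimExp β d - σ)) ^ n := by
    funext n
    rw [← rpow_dimExp hβ hd, ← Real.rpow_natCast, ← Real.rpow_natCast, ← Real.rpow_natCast,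
      ← Real.rpow_mul hβ0.le, ← Real.rpow_mul hβ0.le, ← Real.rpow_mul hβ0.le,
      ← Real.rpow_add hβ0]
    congr 1; ring
  rw [this]
  refine summable_geometric_of_lt_one (by positivity) (Real.rpow_lt_one_of_one_lt_of_neg hβ ?_)
  linarith

lemma summable_val_rpow {β : ℝ} (hβ : 1 < β) {d : Finset ℝ} (hd : IsDigitSet d) {b : ℕ → ℝ}
    {c₀ : ℝ} (hc₀ : 0 < c₀) (hb : ∀ k, c₀ * β ^ k ≤ b k) {σ : ℝ} (hσ : dimExp β d < σ) :
    Summable fun w : NzWord d => w.1.val b ^ (-σ) := by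
  obtain ⟨c, hc, hcw⟩ := exists_le_val hβ hd hc₀ hb
  have hβ0 : 0 < β := by linarith
  have hσ0 : 0 < σ := (dimExp_pos hβ hd).trans hσ
  have h1 : Summable fun w : Word d => (β ^ w.deg) ^ (-σ) :=
    Word.summable_of_deg (g := fun n => (β ^ n) ^ (-σ)) (fun n => by positivity)
      (summable_pow_mul_rpow hβ hd hσ)
  have h2 := (h1.comp_injective (i := fun w : NzWord d => w.1)
    Subtype.val_injective).mul_left (c ^ (-σ))
  refine h2.of_nonneg_of_le (fun w => ?_) fun w => ?_
  · exact Real.rpow_nonneg (le_trans (by positivity) (hcw w)) _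
  · rw [Function.comp_apply, ← Real.mul_rpow hc.le (by positivity)]
    exact Real.rpow_le_rpow_of_nonpos (by positivity) (hcw w) (by linarith)

lemma val_pos {β : ℝ} (hβ : 1 < β) {d : Finset ℝ} (hd : IsDigitSet d) {b : ℕ → ℝ}
    {c₀ : ℝ} (hc₀ : 0 < c₀) (hb : ∀ k, c₀ * β ^ k ≤ b k) (w : NzWord d) : 0 < w.1.val b := by
  obtain ⟨c, hc, hcw⟩ := exists_le_val hβ hd hc₀ hb
  have hβ0 : 0 < β := by linarith
  exact lt_of_lt_of_le (by positivity) (hcw w)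

/-- The terms of a convergent series tend to `0`, whereas a nonzero digit contributes at least
(smallest nonzero digit) times `c₀`. So a representing sequence is eventually zero, that is, a word.
-/
lemma represents_iff {β : ℝ} (hβ : 1 < β) {d : Finset ℝ} (hd : IsDigitSet d) {b : ℕ → ℝ}
    {c₀ : ℝ} (hc₀ : 0 < c₀) (hb : ∀ k, c₀ * β ^ k ≤ b k) (δ : ℕ → ℝ) (x : ℝ) :
    Represents b d δ x ↔ ∃ w : Word d, w.1 = δ ∧ w.val b = x := by
  constructor
  · rintro ⟨hδ, hs⟩
    have hfin : (Function.support δ).Finite := by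
      obtain ⟨a, ha, hgap⟩ := hd.exists_gap
      have h0 := hs.summable.tendsto_atTop_zero
      have h1 : ∀ᶠ k in atTop, δ k * b k < a * c₀ := h0.eventually_lt_const (by positivity)
      obtain ⟨n, hn⟩ := eventually_atTop.mp h1
      refine (Set.finite_lt_nat n).subset fun k hk => ?_
      by_contra hkn
      have h2 := hn k (not_lt.mp hkn)
      have h3 : a ≤ δ k := hgap _ (hδ k) hk
      have h4 : c₀ ≤ b k := le_trans (le_mul_of_one_le_right hc₀.le (one_le_pow₀ hβ.le)) (hb k)
      exact absurd (mul_le_mul h3 h4 hc₀.le (ha.le.trans h3)) (not_le.mpr h2)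
    exact ⟨⟨δ, hδ, hfin⟩, rfl, (Word.val_hasSum b ⟨δ, hδ, hfin⟩).unique hs⟩
  · rintro ⟨w, rfl, rfl⟩
    exact ⟨w.2.1, Word.val_hasSum b w⟩

lemma countFn_eq {β : ℝ} (hβ : 1 < β) {d : Finset ℝ} (hd : IsDigitSet d) {b : ℕ → ℝ}
    {c₀ : ℝ} (hc₀ : 0 < c₀) (hb : ∀ k, c₀ * β ^ k ≤ b k) (x : ℝ) :
    countFn b d x = Set.ncard {w : Word d | w.val b ≤ x} := by
  rw [countFn, ← Set.ncard_image_of_injective _ (Subtype.val_injective :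
    Function.Injective (fun w : Word d => w.1))]
  congr 1
  ext δ
  simp only [represents_iff hβ hd hc₀ hb, Set.mem_ofPred_eq, Set.mem_image]
  constructor
  · rintro ⟨y, hy, w, hw, rfl⟩; exact ⟨w, hy, hw⟩
  · rintro ⟨w, hw, h⟩; exact ⟨_, hw, w, h, rfl⟩

/-- The zeta function as a sum over nonzero words. -/
lemma hasSum_zetaTerm {β : ℝ} (hβ : 1 < β) {d : Finset ℝ} (hd : IsDigitSet d) {b : ℕ → ℝ}
    {c₀ : ℝ} (hc₀ : 0 < c₀) (hb : ∀ k, c₀ * β ^ k ≤ b k) {s : ℂ} (hs : dimExp β d < s.re) :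
    HasSum (zetaTerm b d s) (∑' w : NzWord d, 1 / (w.1.val b : ℂ) ^ s) := by
  have hsum : Summable fun w : NzWord d => 1 / (w.1.val b : ℂ) ^ s := by
    refine Summable.of_norm ((summable_val_rpow hβ hd hc₀ hb hs).congr fun w => ?_)
    rw [norm_div, norm_one, Complex.norm_cpow_eq_rpow_re_of_pos (val_pos hβ hd hc₀ hb w),
      Real.rpow_neg (val_pos hβ hd hc₀ hb w).le, one_div]
  -- The summand is constant on the fibres of the value map, and the fibre over `x` has `repCount b
  -- d x` elements; the zero word is not missed because `x > 0`.
  let g : NzWord d → {x : ℝ // 0 < x} := fun w => ⟨w.1.val b, val_pos hβ hd hc₀ hb w⟩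
  suffices e : zetaTerm b d s = fun x => ∑' w : g ⁻¹' {x}, 1 / (w.1.1.val b : ℂ) ^ s by
    rw [e]
    exact hsum.hasSum.tsum_fiberwise g
  funext x
  have h1 : ∀ w : g ⁻¹' {x}, 1 / ((w.1.1.val b : ℝ) : ℂ) ^ s = 1 / ((x : ℝ) : ℂ) ^ s := by
    rintro ⟨w, hw⟩
    have : w.1.val b = x := congrArg Subtype.val hw
    rw [this]
  rw [tsum_congr h1, tsum_const, zetaTerm, nsmul_eq_mul, div_eq_mul_one_div]
  congr 2
  rw [repCount, ← Nat.card_coe_set_eq]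
  let f : g ⁻¹' {x} → {δ : ℕ → ℝ | Represents b d δ x} := fun w => ⟨w.1.1.1,
    (represents_iff hβ hd hc₀ hb _ _).mpr ⟨w.1.1, rfl, congrArg Subtype.val w.2⟩⟩
  refine Nat.card_congr (Equiv.ofBijective f ⟨?_, ?_⟩).symm
  · intro w v h
    have h' : w.1.1.1 = v.1.1.1 := congrArg (fun t => t.1) h
    exact Subtype.ext (Subtype.ext (Subtype.ext h'))
  · rintro ⟨δ, hδ⟩
    obtain ⟨w, rfl, hw⟩ := (represents_iff hβ hd hc₀ hb _ _).mp hδ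
    have hw0 : w.deg ≠ 0 := by
      intro h
      rw [Word.deg_eq_zero_iff hd] at h
      rw [h, Word.val_zero] at hw
      exact x.2.ne hw
    exact ⟨⟨⟨w, hw0⟩, Subtype.ext hw⟩, rfl⟩

/-! ### Base `β^k`: the generating function of the words and the counting function. -/

section

open MeasureTheory Set

/-- The value of a word in base `β`. -/
abbrev Word.pval {d : Finset ℝ} (β : ℝ) (w : Word d) : ℝ := w.val (fun k => β ^ k)

/-- The generating function `∑ e^{-δ y}` of the digit set. -/
def digitGen (d : Finset ℝ) (y : ℝ) : ℝ := ∑ δ ∈ d, Real.exp (-δ * y)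

/-- The generating function `∑ e^{-N(w) y}` of all words. -/
def wordGen (β : ℝ) (d : Finset ℝ) (y : ℝ) : ℝ := ∑' w : Word d, Real.exp (-w.pval β * y)

variable {β : ℝ} {d : Finset ℝ}

/-- Supplies the lower bound `c₀ * β ^ k ≤ b k` with `c₀ = 1` when the general lemmas are applied to
the pure base. -/
lemma one_mul_pow_le (β : ℝ) (k : ℕ) : 1 * β ^ k ≤ β ^ k := (one_mul _).le

lemma pval_nonneg (hβ : 1 < β) (hd : IsDigitSet d) (w : Word d) : 0 ≤ w.pval β :=
  w.val_nonneg hd fun k => by positivity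

lemma exists_le_pval (hβ : 1 < β) (hd : IsDigitSet d) :
    ∃ c : ℝ, 0 < c ∧ ∀ w : NzWord d, c * β ^ w.1.deg ≤ w.1.pval β :=
  exists_le_val hβ hd one_pos (one_mul_pow_le β)

lemma summable_pow_mul_exp (hβ : 1 < β) (hd : IsDigitSet d) {c : ℝ} (hc : 0 < c) :
    Summable fun n : ℕ => (d.card : ℝ) ^ n * Real.exp (-c * β ^ n) := by
  have hlim : Tendsto (fun n : ℕ => β ^ n) atTop atTop := tendsto_pow_atTop_atTop_of_one_lt hβ
  have h1 := (isLittleO_exp_neg_mul_rpow_atTop hc (-(dimExp β d + 1))).isBigO.comp_tendsto hlim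
  refine summable_of_isBigO_nat (summable_pow_mul_rpow hβ hd (lt_add_one (dimExp β d))) ?_
  exact (isBigO_refl _ _).mul h1

lemma summable_wordGen (hβ : 1 < β) (hd : IsDigitSet d) {y : ℝ} (hy : 0 < y) :
    Summable fun w : Word d => Real.exp (-w.pval β * y) := by
  obtain ⟨c, hc, hcw⟩ := exists_le_pval hβ hd
  have h1 : Summable fun w : Word d => Real.exp (-(c * y) * β ^ w.deg) :=
    Word.summable_of_deg (g := fun n => Real.exp (-(c * y) * β ^ n)) (fun n => by positivity)
      (summable_pow_mul_exp hβ hd (by positivity))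
  refine (h1.mul_left (Real.exp (c * y))).of_nonneg_of_le (fun w => by positivity) fun w => ?_
  rw [← Real.exp_add, Real.exp_le_exp]
  -- Subtracting `c` makes the lower bound valid for the zero word too, so that one majorant serves
  -- all words.
  have : c * β ^ w.deg - c ≤ w.pval β := by
    by_cases h : w.deg = 0
    · rw [h, pow_zero, mul_one, sub_self]; exact pval_nonneg hβ hd w
    · linarith [hcw ⟨w, h⟩]
  nlinarith

/-- Splitting off the first digit. -/
def consEquiv (d : Finset ℝ) : d × Word d ≃ Word d where
  toFun p := ⟨fun k => Nat.casesOn k p.1.1 p.2.1, fun k => by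
      cases k with
      | zero => exact p.1.2
      | succ k => exact p.2.2.1 k, by
      refine ((p.2.2.2.image (fun k => k + 1)).insert 0).subset ?_
      intro k hk
      cases k with
      | zero => exact Set.mem_insert _ _
      | succ k => exact Set.mem_insert_of_mem _ ⟨k, hk, rfl⟩⟩
  invFun w := (⟨w.1 0, w.2.1 0⟩, ⟨fun k => w.1 (k + 1), fun k => w.2.1 _,
    w.2.2.preimage (f := fun k => k + 1) (fun _ _ _ _ h => Nat.succ_injective h)⟩)
  left_inv p := rfl
  right_inv w := by
    refine Subtype.ext (funext fun k => ?_)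
    cases k <;> rfl

lemma pval_consEquiv (β : ℝ) (δ : d) (w : Word d) :
    (consEquiv d (δ, w)).pval β = δ + β * w.pval β := by
  have h := (Word.val_hasSum (fun k => β ^ k) (consEquiv d (δ, w))).summable.tsum_eq_zero_add
  rw [Word.pval, Word.val, h, Word.pval, Word.val, ← tsum_mul_left]
  congr 1
  · simp [consEquiv]
  · exact tsum_congr fun k => by simp [consEquiv]; ring

/-- A word with first digit `δ` and tail `w` has value `δ + β N(w)`, so the exponential sum factors.
-/
lemma wordGen_eq_mul (hβ : 1 < β) (hd : IsDigitSet d) {y : ℝ} (hy : 0 < y) :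
    wordGen β d y = digitGen d y * wordGen β d (β * y) := by
  have hβy : 0 < β * y := by positivity
  have h1 : ∀ p : d × Word d, Real.exp (-(consEquiv d p).pval β * y)
      = Real.exp (-p.1 * y) * Real.exp (-p.2.pval β * (β * y)) := by
    rintro ⟨δ, w⟩
    rw [pval_consEquiv, ← Real.exp_add]
    congr 1; ring
  have h2 : Summable fun p : d × Word d =>
      Real.exp (-p.1 * y) * Real.exp (-p.2.pval β * (β * y)) :=
    ((consEquiv d).summable_iff.mpr (summable_wordGen hβ hd hy)).congr fun p => h1 p
  rw [wordGen, ← (consEquiv d).tsum_eq, tsum_congr h1, h2.tsum_prod, digitGen,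
    ← Finset.sum_coe_sort, Finset.sum_mul, tsum_fintype]
  refine Finset.sum_congr rfl fun δ _ => ?_
  change ∑' c : Word d, Real.exp (-(δ : ℝ) * y) * Real.exp (-c.pval β * (β * y)) = _
  rw [tsum_mul_left, wordGen]

lemma finite_pval_le (hβ : 1 < β) (hd : IsDigitSet d) (t : ℝ) :
    {w : Word d | w.pval β ≤ t}.Finite := by
  obtain ⟨c, hc, hcw⟩ := exists_le_pval hβ hd
  obtain ⟨n, hn⟩ := pow_unbounded_of_one_lt (t / c) hβ
  refine (Word.finite_deg_le n).subset fun w hw => ?_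
  rw [Set.mem_ofPred_eq] at hw ⊢
  by_contra h
  have h2 := hcw ⟨w, by omega⟩
  rw [div_lt_iff₀ hc] at hn
  have h3 : β ^ n ≤ β ^ w.deg := pow_le_pow_right₀ hβ.le (by omega)
  nlinarith

lemma countPow_eq (hβ : 1 < β) (hd : IsDigitSet d) (t : ℝ) :
    countPow β d t = (Set.ncard {w : Word d | w.pval β ≤ t} : ℝ) := by
  rw [countPow, countFn_eq hβ hd one_pos (one_mul_pow_le β)]

lemma countPow_mono (hβ : 1 < β) (hd : IsDigitSet d) : Monotone (countPow β d) := by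
  intro s t hst
  rw [countPow_eq hβ hd, countPow_eq hβ hd]
  exact_mod_cast Set.ncard_le_ncard (fun w hw => le_trans hw hst) (finite_pval_le hβ hd t)

lemma countPow_nonneg (β : ℝ) (d : Finset ℝ) (t : ℝ) : 0 ≤ countPow β d t := Nat.cast_nonneg _

/-- A nonzero word of value at most `t` has degree at most `log_β (t / c)`, and `|d|^(log_β (t / c))
= (t / c)^D`. For `t < c` only the zero word counts, whence the summand `1`. -/
lemma exists_countPow_le (hβ : 1 < β) (hd : IsDigitSet d) :
    ∃ C : ℝ, 1 ≤ C ∧ ∀ t, 0 ≤ t → countPow β d t ≤ C * (1 + t ^ dimExp β d) := by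
  obtain ⟨c, hc, hcw⟩ := exists_le_pval hβ hd
  refine ⟨max 1 (c⁻¹ ^ dimExp β d), le_max_left _ _, fun t ht => ?_⟩
  have hfin := finite_pval_le hβ hd t
  rw [countPow_eq hβ hd, Set.ncard_eq_toFinset_card _ hfin]
  have hD := dimExp_pos hβ hd
  have hβ0 : 0 < β := by linarith
  have hmem : ∀ w ∈ hfin.toFinset, w.pval β ≤ t := fun w hw => by simpa using hw
  have htD : 0 ≤ t ^ dimExp β d := Real.rpow_nonneg ht _
  have hle1 := le_max_left 1 (c⁻¹ ^ dimExp β d)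
  have hle2 := le_max_right 1 (c⁻¹ ^ dimExp β d)
  rcases lt_or_ge t c with htc | htc
  · have h1 : (hfin.toFinset.card : ℝ) ≤ (d.card : ℝ) ^ 0 := by
      refine mod_cast Word.card_le_of_deg_le _ 0 fun w hw => ?_
      by_contra h
      have h2 := hcw ⟨w, by omega⟩
      have h3 : c ≤ c * β ^ w.deg := le_mul_of_one_le_right hc.le (one_le_pow₀ hβ.le)
      linarith [hmem w hw]
    rw [pow_zero] at h1
    nlinarith
  · have htc1 : 1 ≤ t / c := (one_le_div hc).mpr htc
    have hlog : 0 ≤ Real.logb β (t / c) := Real.logb_nonneg hβ htc1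
    have h1 : (hfin.toFinset.card : ℝ) ≤ (d.card : ℝ) ^ ⌊Real.logb β (t / c)⌋₊ := by
      refine mod_cast Word.card_le_of_deg_le _ _ fun w hw => ?_
      rcases Nat.eq_zero_or_pos w.deg with h | h
      · omega
      refine Nat.le_floor ?_
      rw [Real.le_logb_iff_rpow_le hβ (by positivity), Real.rpow_natCast, le_div_iff₀ hc]
      linarith [hcw ⟨w, by omega⟩, hmem w hw]
    refine h1.trans ?_
    rw [← Real.rpow_natCast]
    refine (Real.rpow_le_rpow_of_exponent_le hd.one_lt_card.le (Nat.floor_le hlog)).trans ?_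
    have h2 : (d.card : ℝ) ^ Real.logb β (t / c) = c⁻¹ ^ dimExp β d * t ^ dimExp β d := by
      rw [← rpow_dimExp hβ hd, ← Real.rpow_mul hβ0.le, mul_comm (dimExp β d), Real.rpow_mul hβ0.le,
        Real.rpow_logb hβ0 hβ.ne' (by positivity), ← Real.mul_rpow (by positivity) ht]
      congr 1
      field_simp
    rw [h2]
    nlinarith

/-- Sum `e^{-N y} = y ∫_N^∞ e^{-y t} dt` over all words and interchange; at each `t` the indicators
add up to the count. -/
lemma wordGen_eq_integral (hβ : 1 < β) (hd : IsDigitSet d) {y : ℝ} (hy : 0 < y) :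
    wordGen β d y = y * ∫ t in Ioi (0 : ℝ), Real.exp (-y * t) * countPow β d t := by
  let F : Word d → ℝ → ℝ := fun w => (Ici (w.pval β)).indicator (fun t => Real.exp (-y * t))
  have hint0 : ∀ w : Word d, Integrable (F w) (volume.restrict (Ioi 0)) := fun w =>
    (integrableOn_exp_mul_Ioi (by linarith) 0).indicator measurableSet_Ici
  have hF0 : ∀ w t, 0 ≤ F w t := fun w t => indicator_nonneg (fun t _ => (Real.exp_pos _).le) t
  have hval : ∀ w : Word d, ∫ t in Ioi 0, F w t = y⁻¹ * Real.exp (-w.pval β * y) := by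
    intro w
    have h1 : (Ioi (0 : ℝ) ∩ Ici (w.pval β) : Set ℝ) =ᵐ[volume] Ioi (w.pval β) := by
      have h2 : (Ioi (0 : ℝ) ∩ Ici (w.pval β) : Set ℝ) =ᵐ[volume] (Ioi 0 ∩ Ioi (w.pval β) : Set ℝ) :=
        (ae_eq_refl _).inter Ioi_ae_eq_Ici.symm
      rwa [Ioi_inter_Ioi, max_eq_right (pval_nonneg hβ hd w)] at h2
    rw [setIntegral_indicator measurableSet_Ici, setIntegral_congr_set h1,
      integral_exp_mul_Ioi (by linarith)]
    rw [neg_div_neg_eq, div_eq_inv_mul]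
    congr 2; ring
  have hsum : Summable fun w : Word d => ∫ t in Ioi 0, ‖F w t‖ := by
    refine ((summable_wordGen hβ hd hy).mul_left y⁻¹).congr fun w => ?_
    rw [← hval w]
    exact integral_congr_ae (Eventually.of_forall fun t => (Real.norm_of_nonneg (hF0 w t)).symm)
  have h := hasSum_integral_of_summable_integral_norm hint0 hsum
  have h2 : ∀ t, ∑' w, F w t = Real.exp (-y * t) * countPow β d t := by
    intro t
    have hfin := finite_pval_le hβ hd t
    rw [tsum_eq_sum (s := hfin.toFinset), countPow_eq hβ hd, Set.ncard_eq_toFinset_card _ hfin,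
      Finset.sum_congr rfl (g := fun _ => Real.exp (-y * t)), Finset.sum_const, nsmul_eq_mul,
      mul_comm]
    · intro w hw
      exact indicator_of_mem (by simpa using hw) _
    · intro w hw
      exact indicator_of_notMem (by simpa using hw) _
  simp_rw [h2] at h
  rw [← h.tsum_eq, ← tsum_mul_left, wordGen]
  refine tsum_congr fun w => ?_
  rw [hval, mul_inv_cancel_left₀ hy.ne']

/-- Monotonicity is used only to obtain local integrability on `(0, ∞)` for the Mellin transform. -/
lemma wordGen_antitoneOn (hβ : 1 < β) (hd : IsDigitSet d) : AntitoneOn (wordGen β d) (Ioi 0) := by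
  intro x hx y hy hxy
  refine (summable_wordGen hβ hd hy).tsum_le_tsum (fun w => ?_) (summable_wordGen hβ hd hx)
  rw [Real.exp_le_exp]
  have := pval_nonneg hβ hd w
  nlinarith

lemma hasSum_wordGen_sub_one (hβ : 1 < β) (hd : IsDigitSet d) {y : ℝ} (hy : 0 < y) :
    HasSum (fun w : NzWord d => Real.exp (-w.1.pval β * y)) (wordGen β d y - 1) := by
  have h := (summable_wordGen hβ hd hy).hasSum
  have h0 : HasSum (fun w : {w : Word d // w.deg = 0} => Real.exp (-w.1.pval β * y)) 1 := by
    have : ∀ w : {w : Word d // w.deg = 0}, w = ⟨Word.zero hd, (Word.deg_eq_zero_iff hd _).mpr rfl⟩ :=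
      fun w => Subtype.ext ((Word.deg_eq_zero_iff hd _).mp w.2)
    convert hasSum_single (f := fun w : {w : Word d // w.deg = 0} => Real.exp (-w.1.pval β * y))
      ⟨Word.zero hd, (Word.deg_eq_zero_iff hd _).mpr rfl⟩ (fun w hw => absurd (this w) hw)
    simp
  have h1 : Summable (fun w : NzWord d => Real.exp (-w.1.pval β * y)) :=
    (summable_wordGen hβ hd hy).comp_injective Subtype.val_injective
  have h2 : HasSum (fun w : Word d => Real.exp (-w.pval β * y)) (1 + ∑' w : NzWord d, Real.exp (-w.1.pval β * y)) :=
    HasSum.add_compl (s := {w : Word d | w.deg = 0}) h0 h1.hasSum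
  have h3 : wordGen β d y = 1 + ∑' w : NzWord d, Real.exp (-w.1.pval β * y) := h.unique h2
  rw [h3, add_sub_cancel_left]
  exact h1.hasSum

lemma wordGen_sub_one_isBigO (hβ : 1 < β) (hd : IsDigitSet d) :
    ∃ c : ℝ, 0 < c ∧ (fun y => wordGen β d y - 1) =O[atTop] fun y => Real.exp (-c * y) := by
  obtain ⟨c, hc, hcw⟩ := exists_le_pval hβ hd
  refine ⟨c, hc, IsBigO.of_bound (Real.exp c * (wordGen β d 1 - 1)) ?_⟩
  filter_upwards [eventually_ge_atTop 1] with y hy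
  have h1 := hasSum_wordGen_sub_one hβ hd (zero_lt_one.trans_le hy)
  have h2 := hasSum_wordGen_sub_one hβ hd zero_lt_one
  rw [Real.norm_of_nonneg (h1.nonneg fun _ => (Real.exp_pos _).le),
    Real.norm_of_nonneg (Real.exp_pos _).le]
  -- Compare with `y = 1`: for `N ≥ c` and `y ≥ 1`, `(N - c)(y - 1) ≥ 0` gives `e^{-N y} ≤ e^{c - c
  -- y} e^{-N}`.
  have h3 := hasSum_le (fun w : NzWord d => ?_) h1 (h2.mul_left (Real.exp (c - c * y)))
  · refine h3.trans (le_of_eq ?_)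
    rw [sub_eq_add_neg, Real.exp_add, neg_mul]; ring
  · rw [← Real.exp_add, Real.exp_le_exp]
    have h4 : c ≤ w.1.pval β :=
      (le_mul_of_one_le_right hc.le (one_le_pow₀ hβ.le)).trans (hcw w)
    nlinarith

end

/-! ### Taylor coefficients of an exponential as sums over partitions. -/

/-- Uniqueness of asymptotic expansions at `0`: let `y → 0` to kill the constant term, divide by
`y`, repeat. -/
lemma coeff_eq_zero_of_isBigO {n : ℕ} {a : ℕ → ℝ}
    (h : (fun y : ℝ => ∑ j ∈ Finset.range n, a j * y ^ j) =O[𝓝[≠] 0] fun y => y ^ n) :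
    ∀ j < n, a j = 0 := by
  induction n generalizing a with
  | zero => intro j hj; omega
  | succ n ih =>
    have h0 : a 0 = 0 := by
      have h1 : Tendsto (fun y : ℝ => ∑ j ∈ Finset.range (n + 1), a j * y ^ j) (𝓝[≠] 0)
          (𝓝 (∑ j ∈ Finset.range (n + 1), a j * 0 ^ j)) := by
        refine Tendsto.mono_left (Continuous.tendsto ?_ 0) nhdsWithin_le_nhds
        fun_prop
      have h2 : Tendsto (fun y : ℝ => y ^ (n + 1)) (𝓝[≠] 0) (𝓝 0) := by
        refine Tendsto.mono_left ?_ nhdsWithin_le_nhds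
        simpa using (continuous_pow (M := ℝ) (n + 1)).tendsto 0
      have h3 := tendsto_nhds_unique h1 (h.trans_tendsto h2)
      rw [Finset.sum_range_succ'] at h3
      simpa using h3
    have h1 : (fun y : ℝ => ∑ j ∈ Finset.range n, a (j + 1) * y ^ j) =O[𝓝[≠] 0] fun y => y ^ n := by
      have h2 := (isBigO_refl (fun y : ℝ => y⁻¹) (𝓝[≠] 0)).mul h
      refine h2.congr' ?_ ?_
      · filter_upwards [self_mem_nhdsWithin] with y hy
        have hy' : y ≠ 0 := hy
        rw [Finset.sum_range_succ', h0, zero_mul, add_zero, Finset.mul_sum]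
        refine Finset.sum_congr rfl fun j _ => ?_
        rw [pow_succ]; field_simp
      · filter_upwards [self_mem_nhdsWithin] with y hy
        have hy' : y ≠ 0 := hy
        rw [pow_succ]; field_simp
    intro j hj
    cases j with
    | zero => exact h0
    | succ j => exact ih h1 j (by omega)

/-- The coefficients of `exp (∑ q_h y^h)`, as sums over partitions. -/
def expCoeff (q : ℕ → ℝ) (j : ℕ) : ℝ :=
  ∑ l ∈ (Fintype.piFinset (fun _ : Fin j => Finset.range (j + 1))).filter
      (fun l => ∑ i : Fin j, ((i : ℕ) + 1) * l i = j),
    ∏ i : Fin j, 1 / ((l i).factorial : ℝ) * q ((i : ℕ) + 1) ^ (l i)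

lemma isBigO_prod_sub_prod {ι : Type*} (s : Finset ι) {A B : ι → ℝ → ℝ} {n : ℕ}
    (hA : ∀ i ∈ s, A i =O[𝓝 0] fun _ => (1 : ℝ)) (hB : ∀ i ∈ s, B i =O[𝓝 0] fun _ => (1 : ℝ))
    (h : ∀ i ∈ s, (fun y => A i y - B i y) =O[𝓝 0] fun y => y ^ n) :
    (fun y => ∏ i ∈ s, A i y - ∏ i ∈ s, B i y) =O[𝓝 0] fun y => y ^ n := by
  classical
  induction s using Finset.induction_on with
  | empty => simpa using isBigO_zero _ _
  | insert a s ha ih =>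
    have hB' : (fun y => ∏ i ∈ s, B i y) =O[𝓝 0] fun _ => (1 : ℝ) := by
      have := IsBigO.finsetProd (s := s) (f := B) (g := fun _ _ => (1 : ℝ))
        (fun i hi => hB i (Finset.mem_insert_of_mem hi))
      simpa using this
    have h1 := (hA a (Finset.mem_insert_self a s)).mul
      (ih (fun i hi => hA i (Finset.mem_insert_of_mem hi))
        (fun i hi => hB i (Finset.mem_insert_of_mem hi))
        (fun i hi => h i (Finset.mem_insert_of_mem hi)))
    have h2 := (h a (Finset.mem_insert_self a s)).mul hB'
    refine ((h1.congr_right fun y => one_mul _).add (h2.congr_right fun y => mul_one _)).congr_left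
      fun y => ?_
    rw [Finset.prod_insert ha, Finset.prod_insert ha]
    ring

lemma isBigO_pow_pow_zero {m n : ℕ} (h : n ≤ m) :
    (fun y : ℝ => y ^ m) =O[𝓝 0] fun y => y ^ n := by
  rcases h.eq_or_lt with rfl | h
  · exact isBigO_refl _ _
  · exact (isLittleO_pow_pow h).isBigO

/-- Write the exponential of the truncated sum as a product of the factors `exp (q_h y^h)`, truncate
each one and multiply out. The index set depends on `J`, so only the top coefficient is matched with
`expCoeff`; each coefficient is obtained later by its own choice of `J`. -/
lemma exists_exp_expansion {q : ℕ → ℝ} {f : ℝ → ℝ} (hq0 : q 0 = 0) (J : ℕ)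
    (hf0 : Tendsto f (𝓝 0) (𝓝 0))
    (hf : (fun y => f y - ∑ h ∈ Finset.range (J + 1), q h * y ^ h) =O[𝓝 0] fun y => y ^ (J + 1)) :
    ∃ a : ℕ → ℝ, a J = expCoeff q J ∧
      (fun y => Real.exp (f y) - ∑ j ∈ Finset.range (J + 1), a j * y ^ j) =O[𝓝 0]
        fun y => y ^ (J + 1) := by
  let A : Fin J → ℝ → ℝ := fun i y => Real.exp (q (i + 1) * y ^ ((i : ℕ) + 1))
  let B : Fin J → ℝ → ℝ := fun i y => ∑ l ∈ Finset.range (J + 1),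
    (q (i + 1) * y ^ ((i : ℕ) + 1)) ^ l / (l.factorial : ℝ)
  let S : Finset (Fin J → ℕ) := Fintype.piFinset (fun _ : Fin J => Finset.range (J + 1))
  let g : (Fin J → ℕ) → ℝ := fun l => ∏ i : Fin J, 1 / ((l i).factorial : ℝ) * q ((i : ℕ) + 1) ^ (l i)
  let tot : (Fin J → ℕ) → ℕ := fun l => ∑ i : Fin J, ((i : ℕ) + 1) * l i
  refine ⟨fun j => ∑ l ∈ S.filter (fun l => tot l = j), g l, rfl, ?_⟩
  have hsum : ∀ y : ℝ, ∑ h ∈ Finset.range (J + 1), q h * y ^ h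
      = ∑ i : Fin J, q ((i : ℕ) + 1) * y ^ ((i : ℕ) + 1) := by
    intro y
    rw [Finset.sum_range_succ', hq0, zero_mul, add_zero, Finset.sum_range]
  have h1 : (fun y => Real.exp (f y) - ∏ i, A i y) =O[𝓝 0] fun y => y ^ (J + 1) := by
    have hlim : Tendsto (fun y : ℝ => ∑ h ∈ Finset.range (J + 1), q h * y ^ h) (𝓝 0) (𝓝 0) := by
      have : Continuous (fun y : ℝ => ∑ h ∈ Finset.range (J + 1), q h * y ^ h) := by fun_prop
      have h2 := this.tendsto 0
      rwa [Finset.sum_range_succ', hq0, zero_mul, add_zero, Finset.sum_eq_zero] at h2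
      intro i _; simp
    -- Strict differentiability makes `exp` Lipschitz near `0`, which carries the error from the
    -- exponents over to the exponentials.
    have h2 := (Real.hasStrictDerivAt_exp 0).hasStrictFDerivAt.isBigO_sub.comp_tendsto
      (k := fun y => (f y, ∑ h ∈ Finset.range (J + 1), q h * y ^ h)) (l' := 𝓝 0)
      (by rw [nhds_prod_eq]; exact hf0.prodMk hlim)
    refine (h2.trans hf).congr_left fun y => ?_
    simp only [Function.comp_apply, A]
    rw [hsum, Real.exp_sum]
  have ht : ∀ i : Fin J, Tendsto (fun y : ℝ => q (i + 1) * y ^ ((i : ℕ) + 1)) (𝓝 0) (𝓝 0) := by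
    intro i
    have : Continuous (fun y : ℝ => q (i + 1) * y ^ ((i : ℕ) + 1)) := by fun_prop
    simpa using this.tendsto 0
  have h2 : (fun y => ∏ i, A i y - ∏ i, B i y) =O[𝓝 0] fun y => y ^ (J + 1) := by
    refine isBigO_prod_sub_prod _ (fun i _ => ?_) (fun i _ => ?_) (fun i _ => ?_)
    · have : Continuous (A i) := by fun_prop
      exact (this.tendsto 0).isBigO_one ℝ
    · have : Continuous (B i) := by fun_prop
      exact (this.tendsto 0).isBigO_one ℝ
    · have h3 := (Real.exp_sub_sum_range_isBigO_pow (J + 1)).comp_tendsto (ht i)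
      refine h3.trans ?_
      have h4 : (fun y : ℝ => q (i + 1) * y ^ ((i : ℕ) + 1)) =O[𝓝 0] fun y => y ^ 1 :=
        (isBigO_pow_pow_zero (by omega)).const_mul_left _
      refine (h4.pow (J + 1)).congr (fun y => rfl) fun y => by rw [pow_one]
  have h3 : ∀ y, ∏ i, B i y = ∑ l ∈ S, g l * y ^ tot l := by
    intro y
    simp only [B]
    rw [Finset.prod_univ_sum]
    refine Finset.sum_congr rfl fun l _ => ?_
    simp only [g, tot]
    rw [← Finset.prod_pow_eq_pow_sum, ← Finset.prod_mul_distrib]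
    refine Finset.prod_congr rfl fun i _ => ?_
    rw [mul_pow, ← pow_mul]; ring
  have h4 : (fun y => ∏ i, B i y - ∑ j ∈ Finset.range (J + 1),
      (∑ l ∈ S.filter (fun l => tot l = j), g l) * y ^ j) =O[𝓝 0] fun y => y ^ (J + 1) := by
    -- What the collected coefficients miss are the monomials of weight `tot l ≥ J + 1`, each of
    -- them `O(y^(J+1))`.
    have h5 : ∀ y : ℝ, ∏ i, B i y - ∑ j ∈ Finset.range (J + 1),
        (∑ l ∈ S.filter (fun l => tot l = j), g l) * y ^ j
        = ∑ l ∈ S.filter (fun l => ¬ tot l < J + 1), g l * y ^ tot l := by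
      intro y
      rw [h3, ← Finset.sum_filter_add_sum_filter_not S (fun l => tot l < J + 1)]
      have h6 : ∑ l ∈ S.filter (fun l => tot l < J + 1), g l * y ^ tot l
          = ∑ j ∈ Finset.range (J + 1), (∑ l ∈ S.filter (fun l => tot l = j), g l) * y ^ j := by
        rw [← Finset.sum_fiberwise_of_maps_to (t := Finset.range (J + 1)) (g := tot)
          (fun l hl => Finset.mem_range.mpr (Finset.mem_filter.mp hl).2)]
        refine Finset.sum_congr rfl fun j hj => ?_
        rw [Finset.sum_mul, Finset.filter_filter]
        refine Finset.sum_congr ?_ fun l hl => ?_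
        · ext l
          simp only [Finset.mem_filter]
          have := Finset.mem_range.mp hj
          constructor
          · rintro ⟨h, -, h'⟩; exact ⟨h, h'⟩
          · rintro ⟨h, h'⟩; exact ⟨h, by omega, h'⟩
        · rw [(Finset.mem_filter.mp hl).2]
      rw [h6]; ring
    refine IsBigO.congr_left ?_ fun y => (h5 y).symm
    refine IsBigO.fun_sum fun l hl => ?_
    exact (isBigO_pow_pow_zero (by simpa using (Finset.mem_filter.mp hl).2)).const_mul_left _
  refine ((h1.add h2).add h4).congr_left fun y => ?_
  ring

lemma taylor_isBigO_of_analyticAt {f : ℝ → ℝ} (hf : AnalyticAt ℝ f 0) (n : ℕ) :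
    (fun y => f y - ∑ j ∈ Finset.range n, iteratedDeriv j f 0 / (j.factorial : ℝ) * y ^ j)
      =O[𝓝 0] fun y => y ^ n := by
  have h := hf.hasFPowerSeriesAt.isBigO_sub_partialSum_pow n
  refine (h.congr_left fun y => ?_).trans ?_
  · rw [zero_add, FormalMultilinearSeries.partialSum]
    congr 1
    refine Finset.sum_congr rfl fun j _ => ?_
    simp [FormalMultilinearSeries.ofScalars, mul_comm]
  · refine IsBigO.of_bound 1 (Eventually.of_forall fun y => ?_)
    simp

lemma exp_isBigO_expCoeff {q : ℕ → ℝ} {f : ℝ → ℝ} (hq0 : q 0 = 0)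
    (hfa : AnalyticAt ℝ f 0)
    (hf : ∀ n, (fun y => f y - ∑ h ∈ Finset.range n, q h * y ^ h) =O[𝓝 0] fun y => y ^ n) (n : ℕ) :
    (fun y => Real.exp (f y) - ∑ j ∈ Finset.range n, expCoeff q j * y ^ j) =O[𝓝 0]
        fun y => y ^ n := by
  have hf0 : Tendsto f (𝓝 0) (𝓝 0) := by
    have h1 : Tendsto (fun y : ℝ => y ^ 1) (𝓝 0) (𝓝 0) := by
      simpa using (continuous_pow (M := ℝ) 1).tendsto 0
    simpa [hq0] using (hf 1).trans_tendsto h1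
  have hea : AnalyticAt ℝ (fun y => Real.exp (f y)) 0 := hfa.rexp
  -- The expansion of order `J + 1` and the Taylor expansion agree coefficientwise; read off the
  -- coefficient of index `J`.
  have key : ∀ j, iteratedDeriv j (fun y => Real.exp (f y)) 0 / (j.factorial : ℝ) = expCoeff q j := by
    intro J
    obtain ⟨a, ha, ho⟩ := exists_exp_expansion hq0 J hf0 (hf (J + 1))
    have h2 := (ho.sub (taylor_isBigO_of_analyticAt hea (J + 1))).mono
      (nhdsWithin_le_nhds (s := {0}ᶜ))
    have h3 := coeff_eq_zero_of_isBigO (n := J + 1) (a := fun j =>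
      iteratedDeriv j (fun y => Real.exp (f y)) 0 / (j.factorial : ℝ) - a j)
      (h2.congr_left fun y => by
        simp only [sub_mul, Finset.sum_sub_distrib]; ring) J (by omega)
    rw [← ha]
    exact sub_eq_zero.mp h3
  refine (taylor_isBigO_of_analyticAt hea n).congr_left fun y => ?_
  simp_rw [key]


/-! ### The local solution of `|d| E(y) = g(y) E(βy)`. -/

lemma IsDigitSet.digitGen_pos {d : Finset ℝ} (hd : IsDigitSet d) (y : ℝ) : 0 < digitGen d y :=
  Finset.sum_pos (fun _ _ => Real.exp_pos _) ⟨0, hd.zero_mem⟩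

lemma coeffC_eq_expCoeff (β : ℝ) (d : Finset ℝ) (j : ℕ) :
    coeffC β d j = expCoeff (fun h => logGenCoeff d h / (1 - β ^ h)) j := rfl

lemma analyticAt_logGen {d : Finset ℝ} (hd : IsDigitSet d) : AnalyticAt ℝ (logGen d) 0 := by
  refine AnalyticAt.log ?_ (hd.digitGen_pos 0)
  refine Finset.analyticAt_fun_sum _ fun δ _ => ?_
  fun_prop

/-- The local expansion of `E = exp (∑ (L_h / (1 - β^h)) y^h)`. -/
lemma exists_local_factor {β : ℝ} (hβ : 1 < β) {d : Finset ℝ} (hd : IsDigitSet d) :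
    ∃ E : ℝ → ℝ, (∀ y, 0 < E y) ∧
      (∃ ρ : ℝ, 0 < ρ ∧ ∀ y, |β * y| < ρ → d.card * E y = digitGen d y * E (β * y)) ∧
      Tendsto E (𝓝 0) (𝓝 1) ∧
      ∀ n, (fun y => E y - ∑ j ∈ Finset.range n, coeffC β d j * y ^ j) =O[𝓝 0] fun y => y ^ n := by
  set L : ℕ → ℝ := logGenCoeff d with hL
  set q : ℕ → ℝ := fun h => L h / (1 - β ^ h) with hq
  have hq0 : q 0 = 0 := by simp [hq]
  have hLs : HasFPowerSeriesAt (logGen d) (FormalMultilinearSeries.ofScalars ℝ L) 0 :=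
    (analyticAt_logGen hd).hasFPowerSeriesAt
  obtain ⟨r, hr⟩ := hLs
  obtain ⟨ρ, hρ0, hρr⟩ := ENNReal.lt_iff_exists_nnreal_btwn.mp hr.r_pos
  have hρ : 0 < (ρ : ℝ) := by exact_mod_cast hρ0
  have hLsum : ∀ y : ℝ, |y| < ρ → HasSum (fun h => L h * y ^ h) (logGen d y) := by
    intro y hy
    have hy' : y ∈ Metric.eball (0 : ℝ) r := by
      rw [mem_eball_zero_iff]
      refine lt_trans ?_ hρr
      rw [enorm_eq_nnnorm]
      exact_mod_cast hy
    have := hr.hasSum hy'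
    rw [zero_add] at this
    rwa [FormalMultilinearSeries.ofScalars_apply_eq'] at this
  -- For `h ≥ 1` the denominator satisfies `|1 - β^h| ≥ β - 1`, so the series of `q` converges
  -- wherever that of `L` converges absolutely.
  have hqL : ∀ h, |q h| ≤ (β - 1)⁻¹ * |L h| := by
    intro h
    rcases Nat.eq_zero_or_pos h with rfl | hh
    · rw [hq0, abs_zero]
      have : 0 < β - 1 := by linarith
      positivity
    · have h1 : β - 1 ≤ β ^ h - 1 := by
        have := le_self_pow₀ hβ.le hh.ne'
        linarith
      rw [hq, abs_div, div_eq_inv_mul, abs_sub_comm, abs_of_pos (by linarith : 0 < β ^ h - 1)]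
      gcongr
  set p := FormalMultilinearSeries.ofScalars ℝ q with hp
  have hrad : 0 < p.radius := by
    have h2 : Summable fun h => |L h| * |(ρ / 2 : ℝ)| ^ h := by
      have := (hLsum (ρ / 2) (by rw [abs_of_pos (by positivity)]; linarith)).summable.abs
      simpa [abs_mul, abs_pow] using this
    have h1 : ((ρ / 2 : NNReal) : ENNReal) ≤ p.radius := by
      refine p.le_radius_of_summable ?_
      refine (h2.mul_left (β - 1)⁻¹).of_nonneg_of_le (fun n => by positivity) fun n => ?_
      rw [FormalMultilinearSeries.ofScalars_norm, Real.norm_eq_abs, ← mul_assoc, NNReal.coe_div,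
        NNReal.coe_ofNat, abs_of_pos (half_pos hρ)]
      exact mul_le_mul_of_nonneg_right (hqL n) (by positivity)
    refine lt_of_lt_of_le ?_ h1
    have h3 : (0 : NNReal) < ρ := by exact_mod_cast hρ
    exact_mod_cast half_pos h3
  have hps : HasFPowerSeriesOnBall p.sum p 0 p.radius := p.hasFPowerSeriesOnBall hrad
  have hell : ∀ y : ℝ, |y| < ρ → HasSum (fun h => q h * y ^ h) (p.sum y) := by
    intro y hy
    have h1 : Summable fun h => q h * y ^ h := by
      refine Summable.of_norm_bounded (g := fun h => (β - 1)⁻¹ * |L h * y ^ h|)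
        ((hLsum y hy).summable.abs.mul_left _) fun h => ?_
      rw [norm_mul, Real.norm_eq_abs, Real.norm_eq_abs, abs_mul, ← mul_assoc]
      exact mul_le_mul_of_nonneg_right (hqL h) (abs_nonneg _)
    have h2 : p.sum y = ∑' h, q h * y ^ h := FormalMultilinearSeries.ofScalars_sum_eq q y
    rw [h2]
    exact h1.hasSum
  refine ⟨fun y => Real.exp (p.sum y), fun y => Real.exp_pos _, ⟨ρ, hρ, fun y hy => ?_⟩, ?_, ?_⟩
  · have hy1 : |y| < ρ := by
      refine lt_of_le_of_lt ?_ hy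
      rw [abs_mul, abs_of_pos (by linarith : 0 < β)]
      exact le_mul_of_one_le_left (abs_nonneg y) hβ.le
    have h1 := ((hell y hy1).sub (hell _ hy))
    -- The choice of `q` is dictated by `q_h (1 - β^h) = L_h` for `h ≥ 1`; the constant term `L_0 =
    -- log |d|` cannot be absorbed and produces the factor `|d|`.
    have h2 : HasSum (fun h => q h * y ^ h - q h * (β * y) ^ h) (logGen d y - logGen d 0) := by
      have h4 := (hLsum y hy1).sub (hasSum_ite_eq 0 (L 0))
      have h5 : L 0 = logGen d 0 := by simp [hL, logGenCoeff]
      rw [h5] at h4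
      refine h4.congr_fun fun h => ?_
      rcases Nat.eq_zero_or_pos h with rfl | hh
      · simp [hq0, h5]
      · have h6 : 1 - β ^ h ≠ 0 := by
          have := one_lt_pow₀ hβ hh.ne'
          linarith
        rw [if_neg hh.ne', hq, mul_pow]
        field_simp
        ring
    have h3 := h1.unique h2
    have h7 : ∀ z, Real.exp (logGen d z) = digitGen d z := fun z =>
      Real.exp_log (hd.digitGen_pos z)
    have h8 : digitGen d 0 = d.card := by simp [digitGen]
    have h9 : p.sum y + logGen d 0 = logGen d y + p.sum (β * y) := by linarith
    rw [← h8, ← h7, ← h7, ← Real.exp_add, ← Real.exp_add, add_comm, h9]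
  · have h1 : Tendsto p.sum (𝓝 0) (𝓝 (p.sum 0)) := hps.analyticAt.continuousAt
    have h0 : p.sum 0 = 0 := by
      have := (hell 0 (by simpa using hρ)).unique (hasSum_single 0 fun h hh => by simp [hh])
      rw [this, hq0, zero_mul]
    rw [h0] at h1
    simpa using h1.rexp
  · intro n
    simp_rw [coeffC_eq_expCoeff]
    refine exp_isBigO_expCoeff hq0 hps.analyticAt (fun n => ?_) n
    have h := hps.hasFPowerSeriesAt.isBigO_sub_partialSum_pow n
    refine (h.congr_left fun y => ?_).trans ?_
    · rw [zero_add, FormalMultilinearSeries.partialSum]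
      congr 1
      refine Finset.sum_congr rfl fun j _ => ?_
      simp [hp, FormalMultilinearSeries.ofScalars, mul_comm]
    · refine IsBigO.of_bound 1 (Eventually.of_forall fun y => ?_)
      simp

/-! ### The relative density as a limit of normalized counts, and the behaviour of `G` near `0`. -/

section

open MeasureTheory Set

variable {β : ℝ} {d : Finset ℝ}

/-- The counting form of splitting off the first digit: `δ + β N(w) ≤ β t` means `N(w) ≤ t - δ / β`.
-/
lemma countPow_mul (hβ : 1 < β) (hd : IsDigitSet d) (t : ℝ) :
    countPow β d (β * t) = ∑ δ ∈ d, countPow β d (t - β⁻¹ * δ) := by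
  have hβ0 : 0 < β := by linarith
  have hiff : ∀ (δ : d) (w : Word d),
      (consEquiv d (δ, w)).pval β ≤ β * t ↔ w.pval β ≤ t - β⁻¹ * δ := by
    intro δ w
    rw [pval_consEquiv, le_sub_iff_add_le, ← mul_le_mul_iff_right₀ hβ0 (b := w.pval β + _), mul_add,
      mul_inv_cancel_left₀ hβ0.ne', add_comm]
  let e : {w : Word d // w.pval β ≤ β * t} ≃ Σ δ : d, {w : Word d // w.pval β ≤ t - β⁻¹ * δ} :=
    { toFun := fun w => ⟨((consEquiv d).symm w.1).1, ((consEquiv d).symm w.1).2, by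
        rw [← hiff, Prod.mk.eta, Equiv.apply_symm_apply]; exact w.2⟩
      invFun := fun p => ⟨consEquiv d (p.1, p.2.1), (hiff _ _).mpr p.2.2⟩
      left_inv := fun w => Subtype.ext ((consEquiv d).apply_symm_apply w.1)
      right_inv := fun p => rfl }
  have hfin : ∀ δ : d, Finite {w : Word d // w.pval β ≤ t - β⁻¹ * δ} := fun δ =>
    (finite_pval_le hβ hd (t - β⁻¹ * δ)).to_subtype
  have h := Nat.card_congr e
  rw [Nat.card_sigma] at h
  rw [countPow_eq hβ hd, ← Nat.card_coe_set_eq, ← Finset.sum_coe_sort]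
  simp_rw [countPow_eq hβ hd, ← Nat.card_coe_set_eq]
  exact_mod_cast h

/-- The normalized counting function `S(β^x) / |d|^x`. -/
def normCount (β : ℝ) (d : Finset ℝ) (x : ℝ) : ℝ := countPow β d (β ^ x) / (d.card : ℝ) ^ x

/-- The right side is a summand of the series in `relDensity`, so that series telescopes and `Ψ` is
a limit along `x + ℕ`. -/
lemma normCount_sub (hβ : 1 < β) (hd : IsDigitSet d) (x : ℝ) :
    normCount β d x - normCount β d (x + 1) = (d.card : ℝ)⁻¹ * (1 / (d.card : ℝ) ^ x *
      ∑ δ ∈ d, (countPow β d (β ^ x) - countPow β d (β ^ x - β⁻¹ * δ))) := by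
  have hβ0 : 0 < β := by linarith
  have hm := hd.card_pos
  have hmx : (d.card : ℝ) ^ x ≠ 0 := (Real.rpow_pos_of_pos hm x).ne'
  rw [normCount, normCount, Real.rpow_add hβ0, Real.rpow_one, mul_comm (β ^ x), countPow_mul hβ hd,
    Real.rpow_add hm, Real.rpow_one, Finset.sum_sub_distrib, Finset.sum_const, nsmul_eq_mul]
  field_simp

lemma normCount_nonneg (β : ℝ) (d : Finset ℝ) (x : ℝ) : 0 ≤ normCount β d x :=
  div_nonneg (countPow_nonneg _ _ _) (Real.rpow_nonneg (Nat.cast_nonneg _) _)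

lemma normCount_add_one_le (hβ : 1 < β) (hd : IsDigitSet d) (x : ℝ) :
    normCount β d (x + 1) ≤ normCount β d x := by
  rw [← sub_nonneg, normCount_sub hβ hd]
  refine mul_nonneg (by positivity) (mul_nonneg (by positivity) (Finset.sum_nonneg fun δ hδ => ?_))
  rw [sub_nonneg]
  refine countPow_mono hβ hd ?_
  have : 0 ≤ β⁻¹ * δ := mul_nonneg (by positivity) (hd.nonneg δ hδ)
  linarith

/-- The decrements are nonnegative with partial sums at most `normCount β d x`, so the defining
series of `Ψ` converges. Nonnegativity, periodicity, boundedness and measurability of `Ψ` are all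
read off from this limit. -/
lemma tendsto_normCount (hβ : 1 < β) (hd : IsDigitSet d) (x : ℝ) :
    Tendsto (fun n : ℕ => normCount β d (x + n)) atTop (𝓝 (relDensity β d x)) := by
  let f : ℕ → ℝ := fun h => normCount β d (x + h) - normCount β d (x + (h + 1 : ℕ))
  have hf0 : ∀ h, 0 ≤ f h := fun h => by
    have := normCount_add_one_le hβ hd (x + h)
    simp only [f]
    push_cast
    rw [← add_assoc]
    linarith
  have hsum : ∀ n, ∑ h ∈ Finset.range n, f h = normCount β d x - normCount β d (x + n) := by
    intro n
    rw [Finset.sum_range_sub' (fun h : ℕ => normCount β d (x + h))]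
    simp
  have hs : Summable f := summable_of_sum_range_le (c := normCount β d x) hf0 fun n => by
    rw [hsum]
    linarith [normCount_nonneg β d (x + n)]
  have h1 := hs.hasSum.tendsto_sum_nat
  simp_rw [hsum] at h1
  have h2 : relDensity β d x = normCount β d x - ∑' h, f h := by
    rw [relDensity, normCount, ← tsum_mul_left]
    congr 1
    refine tsum_congr fun h => ?_
    simp only [f]
    push_cast
    rw [← add_assoc, normCount_sub hβ hd, add_comm x]
  rw [h2]
  simpa using h1.const_sub (normCount β d x)

lemma relDensity_nonneg (hβ : 1 < β) (hd : IsDigitSet d) (x : ℝ) : 0 ≤ relDensity β d x :=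
  ge_of_tendsto' (tendsto_normCount hβ hd x) fun _ => normCount_nonneg _ _ _

lemma relDensity_periodic (hβ : 1 < β) (hd : IsDigitSet d) :
    Function.Periodic (relDensity β d) 1 := by
  intro x
  refine tendsto_nhds_unique (tendsto_normCount hβ hd (x + 1)) ?_
  refine ((tendsto_add_atTop_iff_nat 1).mpr (tendsto_normCount hβ hd x)).congr fun n => ?_
  push_cast
  congr 1; ring

lemma exists_relDensity_le (hβ : 1 < β) (hd : IsDigitSet d) :
    ∃ C : ℝ, 0 < C ∧ ∀ x, relDensity β d x ≤ C := by
  obtain ⟨C, hC, hS⟩ := exists_countPow_le hβ hd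
  have hβ0 : 0 < β := by linarith
  -- The factor `2` absorbs `1 + |d|^(x+n) ≤ 2 |d|^(x+n)`, valid once `x + n ≥ 0`.
  refine ⟨C * 2, by linarith, fun x => ?_⟩
  refine le_of_tendsto (tendsto_normCount hβ hd x) ?_
  have h1 : Tendsto (fun n : ℕ => x + n) atTop atTop :=
    tendsto_atTop_add_const_left _ _ tendsto_natCast_atTop_atTop
  filter_upwards [h1.eventually_ge_atTop 0] with n hn
  rw [normCount, div_le_iff₀ (Real.rpow_pos_of_pos hd.card_pos _)]
  refine (hS _ (by positivity)).trans ?_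
  have h2 : (β ^ (x + n)) ^ dimExp β d = (d.card : ℝ) ^ (x + n) := by
    rw [← rpow_dimExp hβ hd, ← Real.rpow_mul hβ0.le, ← Real.rpow_mul hβ0.le, mul_comm]
  have h3 : 1 ≤ (d.card : ℝ) ^ (x + n) := Real.one_le_rpow hd.one_lt_card.le hn
  rw [h2, mul_assoc]
  exact mul_le_mul_of_nonneg_left (by linarith) (by linarith)

lemma measurable_relDensity (hβ : 1 < β) (hd : IsDigitSet d) : Measurable (relDensity β d) := by
  have hβ0 : 0 < β := by linarith
  refine measurable_of_tendsto_metrizable (f := fun (n : ℕ) x => normCount β d (x + n)) (fun n => ?_)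
    (tendsto_pi_nhds.mpr fun x => tendsto_normCount hβ hd x)
  refine Measurable.div ((countPow_mono hβ hd).measurable.comp ?_) ?_ <;> fun_prop

/-- The multiplicatively `β`-periodic function
`φ(y) = ∫ e^{-u} u^D Ψ(log_β (u / y)) du`. -/
def smoothDensity (β : ℝ) (d : Finset ℝ) (y : ℝ) : ℝ :=
  ∫ u in Ioi (0 : ℝ), Real.exp (-u) * u ^ dimExp β d *
    relDensity β d (Real.logb β u - Real.logb β y)

lemma smoothDensity_mul (hβ : 1 < β) (hd : IsDigitSet d) {y : ℝ} (hy : 0 < y) :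
    smoothDensity β d (β * y) = smoothDensity β d y := by
  rw [smoothDensity, smoothDensity]
  refine integral_congr_ae (Eventually.of_forall fun u => ?_)
  dsimp only
  rw [Real.logb_mul (by linarith) hy.ne', Real.logb_self_eq_one hβ,
    ← relDensity_periodic hβ hd (Real.logb β u - (1 + Real.logb β y))]
  congr 2; ring

lemma measurable_logb (β : ℝ) : Measurable (Real.logb β) := by
  unfold Real.logb
  fun_prop

lemma measurable_smoothDensity (hβ : 1 < β) (hd : IsDigitSet d) :
    Measurable (smoothDensity β d) := by
  refine (StronglyMeasurable.integral_prod_right (f := fun (y u : ℝ) => Real.exp (-u) *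
    u ^ dimExp β d * relDensity β d (Real.logb β u - Real.logb β y)) ?_).measurable
  refine Measurable.stronglyMeasurable ?_
  have h1 := measurable_relDensity hβ hd
  have h2 := measurable_logb β
  simp only [Function.uncurry_def]
  fun_prop

lemma integrableOn_exp_mul_rpow {D y : ℝ} (hD : -1 < D) (hy : 0 < y) :
    IntegrableOn (fun u : ℝ => Real.exp (-y * u) * u ^ D) (Ioi 0) := by
  have := integrableOn_rpow_mul_exp_neg_mul_rpow hD one_pos hy
  simp only [Real.rpow_one] at this
  exact this.congr_fun (fun u _ => mul_comm _ _) measurableSet_Ioi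

lemma smoothDensity_nonneg (hβ : 1 < β) (hd : IsDigitSet d) (y : ℝ) : 0 ≤ smoothDensity β d y :=
  setIntegral_nonneg measurableSet_Ioi fun _ hu => mul_nonneg
    (mul_nonneg (Real.exp_pos _).le (Real.rpow_nonneg (le_of_lt hu) _)) (relDensity_nonneg hβ hd _)

lemma exists_smoothDensity_le (hβ : 1 < β) (hd : IsDigitSet d) :
    ∃ C : ℝ, 0 < C ∧ ∀ y, |smoothDensity β d y| ≤ C := by
  obtain ⟨C, hC, hΨ⟩ := exists_relDensity_le hβ hd
  have hint := (integrableOn_exp_mul_rpow (D := dimExp β d)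
    (by linarith [dimExp_pos hβ hd]) one_pos).mul_const C
  refine ⟨|∫ u in Ioi (0 : ℝ), Real.exp (-1 * u) * u ^ dimExp β d * C| + 1, by positivity, fun y => ?_⟩
  rw [abs_of_nonneg (smoothDensity_nonneg hβ hd y)]
  refine le_trans ?_ ((le_abs_self _).trans (le_add_of_nonneg_right zero_le_one))
  refine integral_mono_of_nonneg ?_ hint ?_
  · refine (ae_restrict_iff' measurableSet_Ioi).mpr (Eventually.of_forall fun u hu => ?_)
    exact mul_nonneg
      (mul_nonneg (Real.exp_pos _).le (Real.rpow_nonneg (le_of_lt hu) _)) (relDensity_nonneg hβ hd _)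
  · refine (ae_restrict_iff' measurableSet_Ioi).mpr (Eventually.of_forall fun u hu => ?_)
    dsimp only
    rw [neg_one_mul]
    exact mul_le_mul_of_nonneg_left (hΨ _)
      (mul_nonneg (Real.exp_pos _).le (Real.rpow_nonneg (le_of_lt hu) _))

/-- Substitute `u = y t`, which brings `φ` into the shape of the Laplace integral for `G`. -/
lemma smoothDensity_eq (β : ℝ) (d : Finset ℝ) {y : ℝ} (hy : 0 < y) :
    smoothDensity β d y = y ^ dimExp β d * (y * ∫ t in Ioi (0 : ℝ), Real.exp (-y * t) *
      (t ^ dimExp β d * relDensity β d (Real.logb β t))) := by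
  have h := integral_comp_mul_left_Ioi (fun u => Real.exp (-u) * u ^ dimExp β d *
    relDensity β d (Real.logb β u - Real.logb β y)) 0 hy
  rw [mul_zero, smul_eq_mul] at h
  rw [smoothDensity, ← mul_inv_cancel_left₀ hy.ne' (integral _ _), ← h, mul_left_comm,
    ← integral_const_mul (y ^ dimExp β d)]
  congr 1
  refine setIntegral_congr_fun measurableSet_Ioi fun t ht => ?_
  have ht' : (0 : ℝ) < t := ht
  rw [Real.logb_mul hy.ne' ht'.ne', add_sub_cancel_left, Real.mul_rpow hy.le ht'.le, neg_mul]
  ring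

/-- Rescaling the Laplace integral turns the left side into `y ∫ e^{-y t} S(β^n t) / |d|^n dt`, and
`S(β^n t) / |d|^n → t^D Ψ(log_β t)`. The bound `S(t) ≤ C (1 + t^D)` gives a majorant independent of
`n`, since `(β^n)^D = |d|^n`. -/
lemma tendsto_wordGen (hβ : 1 < β) (hd : IsDigitSet d) {y : ℝ} (hy : 0 < y) :
    Tendsto (fun n : ℕ => wordGen β d (y / β ^ n) / (d.card : ℝ) ^ n) atTop
      (𝓝 (y ^ (-dimExp β d) * smoothDensity β d y)) := by
  have hβ0 : 0 < β := by linarith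
  have hD := dimExp_pos hβ hd
  obtain ⟨C, hC, hS⟩ := exists_countPow_le hβ hd
  have h1 : ∀ n : ℕ, wordGen β d (y / β ^ n) / (d.card : ℝ) ^ n
      = y * ∫ t in Ioi (0 : ℝ), Real.exp (-y * t) * (countPow β d (β ^ n * t) / (d.card : ℝ) ^ n) := by
    intro n
    have hβn : 0 < β ^ n := by positivity
    have h := integral_comp_mul_left_Ioi (fun t => Real.exp (-(y / β ^ n) * t) * countPow β d t) 0 hβn
    rw [mul_zero, smul_eq_mul] at h
    have h2 : ∀ t, Real.exp (-(y / β ^ n) * (β ^ n * t)) = Real.exp (-y * t) := fun t => by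
      congr 1; field_simp
    simp_rw [h2] at h
    simp_rw [← mul_div_assoc]
    rw [integral_div, h, wordGen_eq_integral hβ hd (by positivity)]
    field_simp
  simp_rw [h1]
  rw [smoothDensity_eq β d hy, Real.rpow_neg hy.le, inv_mul_cancel_left₀ (by positivity)]
  refine Tendsto.const_mul y ?_
  refine tendsto_integral_of_dominated_convergence
    (fun t => C * (Real.exp (-y * t) * t ^ (0 : ℝ) + Real.exp (-y * t) * t ^ dimExp β d))
    (fun n => ?_) ?_ (fun n => ?_) ?_
  · have := (countPow_mono hβ hd).measurable
    exact Measurable.aestronglyMeasurable (by fun_prop)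
  · exact ((integrableOn_exp_mul_rpow (by norm_num) hy).add
      (integrableOn_exp_mul_rpow (by linarith) hy)).const_mul C
  · refine (ae_restrict_iff' measurableSet_Ioi).mpr (Eventually.of_forall fun t ht => ?_)
    have ht' : (0 : ℝ) < t := ht
    have hm : 1 ≤ (d.card : ℝ) ^ n := one_le_pow₀ hd.one_lt_card.le
    have hm0 : 0 < (d.card : ℝ) ^ n := by linarith
    rw [Real.norm_of_nonneg (mul_nonneg (Real.exp_pos _).le
      (div_nonneg (countPow_nonneg _ _ _) hm0.le)), Real.rpow_zero, ← mul_add, mul_left_comm]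
    refine mul_le_mul_of_nonneg_left ?_ (Real.exp_pos _).le
    rw [div_le_iff₀ hm0]
    refine (hS _ (by positivity)).trans ?_
    have h2 : (β ^ n * t) ^ dimExp β d = (d.card : ℝ) ^ n * t ^ dimExp β d := by
      rw [Real.mul_rpow (by positivity) ht'.le, ← rpow_dimExp hβ hd, ← Real.rpow_natCast,
        ← Real.rpow_natCast, ← Real.rpow_mul hβ0.le, ← Real.rpow_mul hβ0.le, mul_comm (n : ℝ)]
    rw [h2, mul_assoc]
    refine mul_le_mul_of_nonneg_left ?_ (by linarith)
    linarith
  · refine (ae_restrict_iff' measurableSet_Ioi).mpr (Eventually.of_forall fun t ht => ?_)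
    have ht' : (0 : ℝ) < t := ht
    refine Tendsto.const_mul _ ?_
    refine ((tendsto_normCount hβ hd (Real.logb β t)).const_mul (t ^ dimExp β d)).congr fun n => ?_
    rw [normCount, Real.rpow_add hβ0, Real.rpow_logb hβ0 hβ.ne' ht', Real.rpow_natCast,
      Real.rpow_add hd.card_pos, Real.rpow_natCast, mul_comm t]
    have h3 : (d.card : ℝ) ^ Real.logb β t = t ^ dimExp β d := by
      rw [← rpow_dimExp hβ hd, ← Real.rpow_mul hβ0.le, mul_comm, Real.rpow_mul hβ0.le,
        Real.rpow_logb hβ0 hβ.ne' ht']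
    have h4 : t ^ dimExp β d ≠ 0 := (Real.rpow_pos_of_pos ht' _).ne'
    rw [h3]
    field_simp

/-- The behaviour of the generating function near `0`. -/
lemma exists_wordGen_expansion (hβ : 1 < β) (hd : IsDigitSet d) :
    ∃ E : ℝ → ℝ,
      (∀ n, (fun y => E y - ∑ j ∈ Finset.range n, coeffC β d j * y ^ j) =O[𝓝 0] fun y => y ^ n) ∧
      ∀ᶠ y in 𝓝[>] 0, wordGen β d y = y ^ (-dimExp β d) * smoothDensity β d y * E y := by
  have hβ0 : 0 < β := by linarith
  obtain ⟨E, hE0, ⟨ρ, hρ, hE⟩, hE1, hEn⟩ := exists_local_factor hβ hd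
  refine ⟨E, hEn, ?_⟩
  filter_upwards [Ioo_mem_nhdsGT hρ] with y hy
  have hm := hd.card_pos
  -- By the two functional equations this quotient does not depend on `n`; its limit, with `E → 1`,
  -- is therefore its value at `n = 0`.
  have h1 : ∀ n : ℕ, wordGen β d (y / β ^ n) / (d.card : ℝ) ^ n / E (y / β ^ n)
      = wordGen β d y / E y := by
    intro n
    induction n with
    | zero => simp
    | succ n ih =>
      rw [← ih]
      have hyn : 0 < y / β ^ (n + 1) := div_pos hy.1 (by positivity)
      have e : β * (y / β ^ (n + 1)) = y / β ^ n := by rw [pow_succ]; field_simp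
      have h2 := wordGen_eq_mul hβ hd hyn
      have h3 := hE (y / β ^ (n + 1)) (by
        rw [e, abs_of_pos (div_pos hy.1 (by positivity))]
        exact (div_le_self hy.1.le (one_le_pow₀ hβ.le)).trans_lt hy.2)
      rw [e] at h2 h3
      have h4 := (hE0 (y / β ^ (n + 1))).ne'
      have h5 := (hE0 (y / β ^ n)).ne'
      rw [h2, pow_succ (d.card : ℝ), div_div, div_div, div_eq_div_iff (by positivity) (by positivity)]
      linear_combination (-wordGen β d (y / β ^ n) * (d.card : ℝ) ^ n) * h3
  have h2 : Tendsto (fun n : ℕ => y / β ^ n) atTop (𝓝 0) :=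
    (tendsto_pow_atTop_atTop_of_one_lt hβ).const_div_atTop y
  have h3 := (tendsto_wordGen hβ hd hy.1).div (hE1.comp h2) one_ne_zero
  have h4 := tendsto_nhds_unique (h3.congr fun n => h1 n) tendsto_const_nhds
  have h5 := (hE0 y).ne'
  rw [div_one] at h4
  rw [h4]
  field_simp

end

/-! ### Mellin transforms: remainder terms and one period of `φ`. -/

section

open MeasureTheory Set

variable {β : ℝ} {d : Finset ℝ}

/-- `φ` restricted to `(0, 1]`. -/
def densityCut (β : ℝ) (d : Finset ℝ) : ℝ → ℂ :=
  (Ioc (0 : ℝ) 1).indicator fun y => (smoothDensity β d y : ℂ)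

/-- `φ` restricted to one period `(β⁻¹, 1]`. -/
def densityPeriod (β : ℝ) (d : Finset ℝ) : ℝ → ℂ :=
  (Ioc β⁻¹ 1).indicator fun y => (smoothDensity β d y : ℂ)

lemma locallyIntegrable_indicator_smoothDensity (hβ : 1 < β) (hd : IsDigitSet d) {s : Set ℝ}
    (hs : MeasurableSet s) :
    LocallyIntegrable (s.indicator fun y => (smoothDensity β d y : ℂ)) := by
  obtain ⟨C, -, hC⟩ := exists_smoothDensity_le hβ hd
  have hm : Measurable fun y => (smoothDensity β d y : ℂ) :=
    Complex.measurable_ofReal.comp (measurable_smoothDensity hβ hd)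
  refine (memLp_top_of_bound (hm.indicator hs).aestronglyMeasurable C
    (Eventually.of_forall fun y => ?_)).locallyIntegrable le_top
  refine (norm_indicator_le_norm_self _ _).trans ?_
  rw [Complex.norm_real]
  exact hC y

lemma densityPeriod_eventually_zero (hβ : 1 < β) (d : Finset ℝ) :
    densityPeriod β d =ᶠ[atTop] 0 ∧ densityPeriod β d =ᶠ[𝓝[>] 0] 0 := by
  constructor
  · filter_upwards [eventually_gt_atTop 1] with y hy
    exact indicator_of_notMem (fun h => absurd h.2 (not_le.mpr hy)) _
  · filter_upwards [Ioo_mem_nhdsGT (show (0 : ℝ) < β⁻¹ by positivity)] with y hy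
    exact indicator_of_notMem (fun h => absurd h.1 (not_lt.mpr hy.2.le)) _

/-- The function is bounded and supported away from `0` and `∞`, so its transform is entire. -/
lemma differentiable_mellin_densityPeriod (hβ : 1 < β) (hd : IsDigitSet d) :
    Differentiable ℂ (mellin (densityPeriod β d)) := by
  intro s
  obtain ⟨h1, h2⟩ := densityPeriod_eventually_zero hβ d
  exact mellin_differentiableAt_of_isBigO_rpow (a := s.re + 1) (b := s.re - 1)
    ((locallyIntegrable_indicator_smoothDensity hβ hd measurableSet_Ioc).locallyIntegrableOn _)
    (h1.trans_isBigO (isBigO_zero _ _)) (by linarith)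
    (h2.trans_isBigO (isBigO_zero _ _)) (by linarith)

lemma mellinConvergent_densityCut (hβ : 1 < β) (hd : IsDigitSet d) {w : ℂ} (hw : 0 < w.re) :
    MellinConvergent (densityCut β d) w := by
  refine mellinConvergent_of_isBigO_rpow (a := w.re + 1) (b := 0)
    ((locallyIntegrable_indicator_smoothDensity hβ hd measurableSet_Ioc).locallyIntegrableOn _)
    (EventuallyEq.trans_isBigO (f₂ := fun _ => (0 : ℂ)) ?_ (isBigO_zero _ _)) (by linarith) ?_ hw
  · filter_upwards [eventually_gt_atTop 1] with y hy
    exact indicator_of_notMem (fun h => absurd h.2 (not_le.mpr hy)) _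
  · obtain ⟨C, -, hC⟩ := exists_smoothDensity_le hβ hd
    refine IsBigO.of_bound C (Eventually.of_forall fun y => ?_)
    rw [neg_zero, Real.rpow_zero, norm_one, mul_one]
    refine (norm_indicator_le_norm_self _ _).trans ?_
    rw [Complex.norm_real]
    exact hC y

lemma mellin_congr_Ioi {f g : ℝ → ℂ} (h : ∀ t, 0 < t → f t = g t) (s : ℂ) :
    mellin f s = mellin g s :=
  setIntegral_congr_fun measurableSet_Ioi fun t ht => by simp only [h t ht]

lemma one_sub_cpow_ne_zero (hβ : 1 < β) {w : ℂ} (hw : w.re ≠ 0) :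
    1 - (β : ℂ) ^ (-w) ≠ 0 := by
  intro h
  have h1 : ‖(β : ℂ) ^ (-w)‖ = 1 := by rw [← sub_eq_zero.mp h, norm_one]
  rw [Complex.norm_cpow_eq_rpow_re_of_pos (by linarith), Complex.neg_re] at h1
  have h2 := congrArg Real.log h1
  rw [Real.log_rpow (by linarith), Real.log_one, mul_eq_zero, neg_eq_zero] at h2
  exact h2.elim hw (Real.log_pos hβ).ne'

/-- The Mellin transform of the cut-off `φ` in terms of a single period. -/
lemma mellin_densityCut (hβ : 1 < β) (hd : IsDigitSet d) {w : ℂ} (hw : 0 < w.re) :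
    mellin (densityCut β d) w = mellin (densityPeriod β d) w / (1 - (β : ℂ) ^ (-w)) := by
  have hβ0 : 0 < β := by linarith
  have hc := mellinConvergent_densityCut hβ hd hw
  have h1 := mellin_comp_mul_left (densityCut β d) w hβ0
  have h2 := (hasMellin_sub hc ((MellinConvergent.comp_mul_left hβ0).mpr hc)).2
  rw [h1] at h2
  -- By periodicity of `φ`, dilation by `β` cuts off at `β⁻¹` instead of `1`; on the Mellin side it
  -- multiplies by `β^{-w}`, which replaces summing a geometric series.
  have h3 : ∀ t, 0 < t → densityPeriod β d t = densityCut β d t - densityCut β d (β * t) := by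
    intro t ht
    have hβt : 0 < β * t := by positivity
    have h4 : t ≤ β⁻¹ ↔ β * t ≤ 1 := by rw [← one_div, le_div_iff₀ hβ0, mul_comm]
    simp only [densityPeriod, densityCut, indicator_apply, mem_Ioc, ht, hβt, true_and]
    rw [smoothDensity_mul hβ hd ht]
    have h7 : β⁻¹ < t ↔ ¬ β * t ≤ 1 := by rw [← h4, not_le]
    simp only [h7]
    by_cases h5 : β * t ≤ 1
    · have h6 : t ≤ 1 := (le_mul_of_one_le_left ht.le hβ.le).trans h5
      simp [h5, h6]
    · simp [h5]
  rw [eq_div_iff (one_sub_cpow_ne_zero hβ hw.ne'), mellin_congr_Ioi h3, h2, smul_eq_mul]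
  ring

/-- `∑ e^{-N(w) y} - 1` minus the first `J` terms of its expansion near `0`, cut off at `1`. -/
def mellinRem (β : ℝ) (d : Finset ℝ) (J : ℕ) (y : ℝ) : ℂ :=
  ((wordGen β d y - 1 : ℝ) : ℂ) + (Ioc (0 : ℝ) 1).indicator (fun _ => 1) y -
    ∑ j ∈ Finset.range J, (coeffC β d j : ℂ) • ((y : ℂ) ^ ((j : ℂ) - dimExp β d) • densityCut β d y)

lemma mellinRem_succ (J : ℕ) (y : ℝ) : mellinRem β d (J + 1) y = mellinRem β d J y -
    (coeffC β d J : ℂ) • ((y : ℂ) ^ ((J : ℂ) - dimExp β d) • densityCut β d y) := by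
  rw [mellinRem, mellinRem, Finset.sum_range_succ]
  ring

lemma mellinRem_zero (y : ℝ) : mellinRem β d 0 y =
    ((wordGen β d y - 1 : ℝ) : ℂ) + (Ioc (0 : ℝ) 1).indicator (fun _ => 1) y := by
  simp [mellinRem]

lemma locallyIntegrableOn_wordGen (hβ : 1 < β) (hd : IsDigitSet d) :
    LocallyIntegrableOn (fun y => ((wordGen β d y - 1 : ℝ) : ℂ)) (Ioi 0) := by
  refine (locallyIntegrableOn_iff isOpen_Ioi.isLocallyClosed).mpr fun K hK hKc => ?_
  have h1 := ((wordGen_antitoneOn hβ hd).mono hK).integrableOn_isCompact (μ := volume) hKc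
  exact (h1.sub (integrableOn_const hKc.measure_lt_top.ne)).ofReal

lemma locallyIntegrableOn_mellinRem (hβ : 1 < β) (hd : IsDigitSet d) (J : ℕ) :
    LocallyIntegrableOn (mellinRem β d J) (Ioi 0) := by
  induction J with
  | zero =>
    have h : LocallyIntegrable ((Ioc (0 : ℝ) 1).indicator (fun _ => (1 : ℂ))) :=
      ((integrable_indicator_iff measurableSet_Ioc).mpr (by simp)).locallyIntegrable
    rw [show mellinRem β d 0 = _ from funext mellinRem_zero]
    exact (locallyIntegrableOn_wordGen hβ hd).add (h.locallyIntegrableOn _)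
  | succ J ih =>
    have h1 := (locallyIntegrable_indicator_smoothDensity hβ hd
      (measurableSet_Ioc (a := (0 : ℝ)) (b := 1))).locallyIntegrableOn (Ioi 0)
    have h2 : ContinuousOn (fun y : ℝ => (y : ℂ) ^ ((J : ℂ) - dimExp β d)) (Ioi 0) :=
      continuousOn_of_forall_continuousAt fun t ht =>
        Complex.continuousAt_ofReal_cpow_const _ _ (Or.inr (ne_of_gt ht))
    have h3 := (h1.continuousOn_smul isOpen_Ioi.isLocallyClosed h2).smul (coeffC β d J : ℂ)
    rw [show mellinRem β d (J + 1) = _ from funext (mellinRem_succ J)]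
    exact ih.sub h3

lemma mellinRem_isBigO_atTop (hβ : 1 < β) (hd : IsDigitSet d) (J : ℕ) (a : ℝ) :
    mellinRem β d J =O[atTop] fun y => y ^ (-a) := by
  obtain ⟨c, hc, ho⟩ := wordGen_sub_one_isBigO hβ hd
  have h1 := ho.trans (isLittleO_exp_neg_mul_rpow_atTop hc (-a)).isBigO
  refine (Complex.isBigO_ofReal_left.mpr h1).congr' ?_ EventuallyEq.rfl
  filter_upwards [eventually_gt_atTop 1] with y hy
  have hy' : y ∉ Ioc (0 : ℝ) 1 := fun h => absurd h.2 (not_le.mpr hy)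
  simp [mellinRem, densityCut, indicator_of_notMem hy']

/-- On `(0, 1]` the indicator cancels the `-1`, so near `0` the remainder is `y^{-D} φ(y)` times the
Taylor remainder of `E` of order `J`. -/
lemma mellinRem_isBigO_zero (hβ : 1 < β) (hd : IsDigitSet d) (J : ℕ) :
    mellinRem β d J =O[𝓝[>] 0] fun y => y ^ (-(dimExp β d - J)) := by
  obtain ⟨E, hE, hG⟩ := exists_wordGen_expansion hβ hd
  obtain ⟨C, -, hC⟩ := exists_smoothDensity_le hβ hd
  have h1 : (fun y => y ^ (-dimExp β d) * smoothDensity β d y *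
      (E y - ∑ j ∈ Finset.range J, coeffC β d j * y ^ j)) =O[𝓝[>] 0]
      fun y => y ^ (-(dimExp β d - J)) := by
    have h2 : (smoothDensity β d) =O[𝓝[>] 0] fun _ => (1 : ℝ) :=
      IsBigO.of_bound C (Eventually.of_forall fun y => by simpa using hC y)
    refine (((isBigO_refl (fun y : ℝ => y ^ (-dimExp β d)) _).mul h2).mul
      ((hE J).mono nhdsWithin_le_nhds)).congr' EventuallyEq.rfl ?_
    filter_upwards [self_mem_nhdsWithin] with y hy
    have hy' : (0 : ℝ) < y := hy
    rw [mul_one, ← Real.rpow_natCast, ← Real.rpow_add hy']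
    congr 1; ring
  refine IsBigO.congr' (Complex.isBigO_ofReal_left.mpr h1) ?_ EventuallyEq.rfl
  filter_upwards [hG, Ioo_mem_nhdsGT (zero_lt_one' ℝ)] with y hy hy1
  have hmem : y ∈ Ioc (0 : ℝ) 1 := ⟨hy1.1, hy1.2.le⟩
  simp only [mellinRem, densityCut, indicator_of_mem hmem, hy]
  have h3 : ∀ j : ℕ, (y : ℂ) ^ ((j : ℂ) - dimExp β d) = ((y ^ j * y ^ (-dimExp β d) : ℝ) : ℂ) := by
    intro j
    rw [← Real.rpow_natCast, ← Real.rpow_add hy1.1, Complex.ofReal_cpow hy1.1.le]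
    push_cast
    rw [sub_eq_add_neg]
  simp only [h3, smul_eq_mul]
  push_cast
  rw [mul_sub, Finset.mul_sum, sub_add_cancel]
  congr 1
  refine Finset.sum_congr rfl fun j _ => ?_
  ring

lemma mellinConvergent_mellinRem (hβ : 1 < β) (hd : IsDigitSet d) {J : ℕ} {s : ℂ}
    (hs : dimExp β d - J < s.re) : MellinConvergent (mellinRem β d J) s :=
  mellinConvergent_of_isBigO_rpow (locallyIntegrableOn_mellinRem hβ hd J)
    (mellinRem_isBigO_atTop hβ hd J (s.re + 1)) (lt_add_one _) (mellinRem_isBigO_zero hβ hd J) hs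

lemma differentiableAt_mellin_mellinRem (hβ : 1 < β) (hd : IsDigitSet d) {J : ℕ} {s : ℂ}
    (hs : dimExp β d - J < s.re) : DifferentiableAt ℂ (mellin (mellinRem β d J)) s :=
  mellin_differentiableAt_of_isBigO_rpow (locallyIntegrableOn_mellinRem hβ hd J)
    (mellinRem_isBigO_atTop hβ hd J (s.re + 1)) (lt_add_one _) (mellinRem_isBigO_zero hβ hd J) hs

/-- The continuation of the Mellin transform of `∑ e^{-N(w) y} - 1 + 1_{(0, 1]}` to
`Re s > D - J`. -/
def mellinCont (β : ℝ) (d : Finset ℝ) (J : ℕ) (s : ℂ) : ℂ :=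
  mellin (mellinRem β d J) s + ∑ j ∈ Finset.range J, (coeffC β d j : ℂ) *
    (mellin (densityPeriod β d) (s + ((j : ℂ) - dimExp β d)) /
      (1 - (β : ℂ) ^ (-(s + ((j : ℂ) - dimExp β d)))))

/-- For `Re s > D - J` the transform of the newly subtracted term converges and equals the closed
form that is added back. This consistency permits gluing over all `J`. -/
lemma mellinCont_succ (hβ : 1 < β) (hd : IsDigitSet d) {J : ℕ} {s : ℂ}
    (hs : dimExp β d - J < s.re) : mellinCont β d (J + 1) s = mellinCont β d J s := by
  have hw : 0 < (s + ((J : ℂ) - dimExp β d)).re := by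
    simp only [Complex.add_re, Complex.sub_re, Complex.natCast_re, Complex.ofReal_re]
    linarith
  have h1 := mellinConvergent_mellinRem hβ hd hs
  have h2 : MellinConvergent (fun y : ℝ => (y : ℂ) ^ ((J : ℂ) - dimExp β d) • densityCut β d y) s :=
    MellinConvergent.cpow_smul.mpr (mellinConvergent_densityCut hβ hd hw)
  have h3 := (hasMellin_sub h1 (h2.const_smul (coeffC β d J : ℂ))).2
  have h4 : mellin (mellinRem β d (J + 1)) s = mellin (mellinRem β d J) s - (coeffC β d J : ℂ) *
      (mellin (densityPeriod β d) (s + ((J : ℂ) - dimExp β d)) /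
      (1 - (β : ℂ) ^ (-(s + ((J : ℂ) - dimExp β d))))) := by
    rw [mellin_congr_Ioi (fun t _ => mellinRem_succ J t), h3, mellin_const_smul, mellin_cpow_smul,
      mellin_densityCut hβ hd hw, smul_eq_mul]
  rw [mellinCont, mellinCont, Finset.sum_range_succ, h4]
  ring

lemma mellinCont_eq_of_le (hβ : 1 < β) (hd : IsDigitSet d) {J J' : ℕ} (h : J ≤ J') {s : ℂ}
    (hs : dimExp β d - J < s.re) : mellinCont β d J' s = mellinCont β d J s := by
  induction J', h using Nat.le_induction with
  | base => rfl
  | succ n hn ih =>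
    rw [mellinCont_succ hβ hd, ih]
    have : (J : ℝ) ≤ n := by exact_mod_cast hn
    linarith

/-- Termwise, the transform of `e^{-N y}` is `Γ(s) N^{-s}`; the indicator of `(0, 1]` contributes `1
/ s`. -/
lemma mellinCont_zero (hβ : 1 < β) (hd : IsDigitSet d) {s : ℂ} (hs : dimExp β d < s.re) :
    mellinCont β d 0 s = Complex.Gamma s * zeta (fun k => β ^ k) d s + 1 / s := by
  have hD := dimExp_pos hβ hd
  have hpos : ∀ w : NzWord d, 0 < w.1.pval β := val_pos hβ hd one_pos (one_mul_pow_le β)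
  have h1 : HasSum (fun w : NzWord d => Complex.Gamma s * 1 / (w.1.pval β : ℂ) ^ s)
      (mellin (fun y => ((wordGen β d y - 1 : ℝ) : ℂ)) s) := by
    refine hasSum_mellin (fun w => Or.inr (hpos w)) (by linarith) (fun t ht => ?_) ?_
    · simp_rw [one_mul]
      exact_mod_cast hasSum_wordGen_sub_one hβ hd ht
    · refine (summable_val_rpow hβ hd one_pos (one_mul_pow_le β) hs).congr fun w => ?_
      rw [norm_one, Real.rpow_neg (hpos w).le, one_div]
  have h2 : zeta (fun k => β ^ k) d s = ∑' w : NzWord d, 1 / (w.1.pval β : ℂ) ^ s :=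
    (hasSum_zetaTerm hβ hd one_pos (one_mul_pow_le β) hs).tsum_eq
  have h3 := hasMellin_one_Ioc (s := s) (by linarith)
  have h4 : MellinConvergent (mellinRem β d 0) s :=
    mellinConvergent_mellinRem hβ hd (by simpa using hs)
  have h5 := hasMellin_sub h4 h3.1
  have h6 : mellin (fun y => ((wordGen β d y - 1 : ℝ) : ℂ)) s = mellin (mellinRem β d 0) s - 1 / s := by
    rw [← h3.2, ← h5.2]
    exact mellin_congr_Ioi (fun t _ => by rw [mellinRem_zero, add_sub_cancel_right]) s
  rw [mellinCont, Finset.range_zero, Finset.sum_empty, add_zero, h2, ← tsum_mul_left]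
  simp_rw [← mul_div_assoc]
  rw [h1.tsum_eq, h6, sub_add_cancel]

end

/-! ### Fourier coefficients of `Ψ` from the Mellin transform of one period. -/

section

open MeasureTheory Set

variable {β : ℝ} {d : Finset ℝ}

/-- The imaginary number `-2πik / log β`. -/
def imagPt (β : ℝ) (k : ℤ) : ℂ := -(2 * Real.pi * k * Complex.I / (Real.log β : ℂ))

lemma cpow_imagPt (hβ : 1 < β) {u : ℝ} (hu : 0 < u) (k : ℤ) :
    (u : ℂ) ^ imagPt β k = Complex.exp (-(2 * Real.pi * Complex.I * k * (Real.logb β u : ℝ))) := by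
  have hlog : (Real.log β : ℂ) ≠ 0 := by exact_mod_cast (Real.log_pos hβ).ne'
  rw [Complex.cpow_def_of_ne_zero (by exact_mod_cast hu.ne'), ← Complex.ofReal_log hu.le, imagPt,
    Real.logb]
  congr 1
  push_cast
  field_simp

/-- The reflection `x ↦ v - x` reverses the frequency, which is why `-k` appears; periodicity
removes the shift of the interval. -/
lemma integral_exp_mul_relDensity (hβ : 1 < β) (hd : IsDigitSet d) (k : ℤ) (v : ℝ) :
    ∫ x in (-1 : ℝ)..0, Complex.exp (-(2 * Real.pi * Complex.I * k * x)) *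
      (relDensity β d (v - x) : ℂ) =
    Complex.exp (-(2 * Real.pi * Complex.I * k * v)) * densityFourier β d (-k) := by
  let g : ℝ → ℂ := fun x => (relDensity β d x : ℂ) *
      Complex.exp (-(2 * Real.pi * Complex.I * (-k : ℤ) * x))
  have hg : Function.Periodic g 1 := by
    intro x
    simp only [g]
    rw [relDensity_periodic hβ hd x]
    congr 1
    refine Complex.exp_eq_exp_iff_exists_int.mpr ⟨k, ?_⟩
    push_cast
    ring
  have h1 : ∀ x : ℝ, Complex.exp (-(2 * Real.pi * Complex.I * k * x)) *
      (relDensity β d (v - x) : ℂ) =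
      Complex.exp (-(2 * Real.pi * Complex.I * k * v)) * g (v - x) := by
    intro x
    simp only [g]
    rw [mul_left_comm, ← Complex.exp_add, mul_comm]
    congr 2
    push_cast
    ring
  simp_rw [h1]
  rw [intervalIntegral.integral_const_mul, intervalIntegral.integral_comp_sub_left g v, sub_zero,
    sub_neg_eq_add, hg.intervalIntegral_add_eq v 0, zero_add, densityFourier]

lemma integral_Ioc_rpow {β : ℝ} (hβ : 1 < β) (g : ℝ → ℂ) :
    ∫ y in Ioc β⁻¹ 1, g y = ∫ x in Ioc (-1 : ℝ) 0, (Real.log β * β ^ x) • g (β ^ x) := by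
  have hβ0 : 0 < β := by linarith
  have himg : (fun x : ℝ => β ^ x) '' Ioc (-1 : ℝ) 0 = Ioc β⁻¹ 1 := by
    ext y
    constructor
    · rintro ⟨x, hx, rfl⟩
      refine ⟨?_, ?_⟩
      · rw [← Real.rpow_neg_one]; exact Real.rpow_lt_rpow_of_exponent_lt hβ hx.1
      · rw [← Real.rpow_zero β]; exact Real.rpow_le_rpow_of_exponent_le hβ.le hx.2
    · intro hy
      have hy0 : 0 < y := lt_trans (by positivity) hy.1
      refine ⟨Real.logb β y, ⟨?_, ?_⟩, Real.rpow_logb hβ0 hβ.ne' hy0⟩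
      · rw [Real.lt_logb_iff_rpow_lt hβ hy0, Real.rpow_neg_one]; exact hy.1
      · exact Real.logb_nonpos hβ hy0.le hy.2
  have h := integral_image_eq_integral_abs_deriv_smul (f := fun x : ℝ => β ^ x)
    (f' := fun x => β ^ x * Real.log β) (s := Ioc (-1 : ℝ) 0) measurableSet_Ioc
    (fun x _ => (Real.hasStrictDerivAt_const_rpow hβ0 x).hasDerivAt.hasDerivWithinAt)
    ((Real.strictMono_rpow_of_base_gt_one hβ).injective.injOn) g
  rw [himg] at h
  rw [h]
  refine integral_congr_ae (Eventually.of_forall fun x => ?_)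
  have hl := Real.log_pos hβ
  dsimp only
  rw [abs_of_pos (by positivity), mul_comm]

lemma integral_exp_mul_rpow_imagPt (β : ℝ) {D : ℝ} (hD : 0 < D) (k : ℤ) :
    ∫ u in Ioi (0 : ℝ), ((Real.exp (-u) * u ^ D : ℝ) : ℂ) * (u : ℂ) ^ imagPt β k =
      Complex.Gamma (1 + D + imagPt β k) := by
  have hre : (1 + D + imagPt β k : ℂ).re = 1 + D := by
    simp [imagPt, Complex.div_re]
  rw [Complex.Gamma_eq_integral (by rw [hre]; linarith), Complex.GammaIntegral]
  refine setIntegral_congr_fun measurableSet_Ioi fun u hu => ?_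
  have hu' : (u : ℂ) ≠ 0 := by exact_mod_cast (ne_of_gt hu)
  have hu0 : 0 ≤ u := le_of_lt hu
  rw [add_assoc, add_sub_cancel_left, Complex.cpow_add _ _ hu', Complex.ofReal_mul,
    Complex.ofReal_cpow hu0, mul_assoc]

/-- With `y = β^x` this is a double integral over one period in `x` and over `u > 0`. Integrating
over `x` first gives `Ψ̂(-k) u^{-2πik / log β}`, and the integral over `u` is then a Gamma integral.
-/
lemma mellin_densityPeriod_imagPt (hβ : 1 < β) (hd : IsDigitSet d) (k : ℤ) :
    mellin (densityPeriod β d) (imagPt β k) = (Real.log β : ℂ) *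
      (Complex.Gamma (1 + dimExp β d + imagPt β k) * densityFourier β d (-k)) := by
  have hβ0 : 0 < β := by linarith
  have hD := dimExp_pos hβ hd
  let K : ℝ → ℝ := fun u => Real.exp (-u) * u ^ dimExp β d
  let e : ℝ → ℂ := fun x => Complex.exp (-(2 * Real.pi * Complex.I * k * x))
  have he : ∀ x, ‖e x‖ = 1 := by
    intro x
    simp only [e]
    rw [show -(2 * Real.pi * Complex.I * k * x : ℂ) = ((-(2 * Real.pi * k * x) : ℝ) : ℂ) * Complex.I by
      push_cast; ring]
    exact Complex.norm_exp_ofReal_mul_I _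
  have h1 : mellin (densityPeriod β d) (imagPt β k) =
      ∫ y in Ioc β⁻¹ 1, (y : ℂ) ^ (imagPt β k - 1) * (smoothDensity β d y : ℂ) := by
    have h2 : ∀ y : ℝ, (y : ℂ) ^ (imagPt β k - 1) • densityPeriod β d y =
        (Ioc β⁻¹ 1).indicator (fun y : ℝ => (y : ℂ) ^ (imagPt β k - 1) * (smoothDensity β d y : ℂ)) y := by
      intro y
      rw [densityPeriod, indicator_apply, indicator_apply, smul_eq_mul, mul_ite, mul_zero]
    rw [mellin]
    simp_rw [h2]
    rw [setIntegral_indicator measurableSet_Ioc, inter_eq_self_of_subset_right]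
    exact fun y hy => lt_trans (by positivity) hy.1
  have h2 : ∀ x : ℝ, (Real.log β * β ^ x) • (((β ^ x : ℝ) : ℂ) ^ (imagPt β k - 1) *
      (smoothDensity β d (β ^ x) : ℂ)) = (Real.log β : ℂ) * (e x * ∫ u in Ioi (0 : ℝ),
        ((K u * relDensity β d (Real.logb β u - x) : ℝ) : ℂ)) := by
    intro x
    have hx : 0 < β ^ x := by positivity
    have hx' : ((β ^ x : ℝ) : ℂ) ≠ 0 := by exact_mod_cast hx.ne'
    rw [integral_complex_ofReal, smoothDensity, Real.logb_rpow hβ0 hβ.ne', Complex.cpow_sub _ _ hx',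
      cpow_imagPt hβ hx, Real.logb_rpow hβ0 hβ.ne', Complex.cpow_one, Complex.real_smul]
    simp only [K, e]
    push_cast at hx' ⊢
    field_simp
  rw [h1, integral_Ioc_rpow hβ]
  simp_rw [h2]
  rw [integral_const_mul]
  congr 1
  have h3 : ∀ x : ℝ, e x * ∫ u in Ioi (0 : ℝ),
      ((K u * relDensity β d (Real.logb β u - x) : ℝ) : ℂ) =
      ∫ u in Ioi (0 : ℝ), (K u : ℂ) * (e x * relDensity β d (Real.logb β u - x)) := by
    intro x
    rw [← integral_const_mul]
    congr 1; funext u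
    push_cast; ring
  simp_rw [h3]
  obtain ⟨C, hC, hΨ⟩ := exists_relDensity_le hβ hd
  have hK : IntegrableOn K (Ioi 0) := by
    have := integrableOn_exp_mul_rpow (D := dimExp β d) (by linarith) one_pos
    simpa [neg_one_mul] using this
  -- Fubini applies because `Ψ` is bounded and `|e x| = 1`: the integrand is dominated by `C * K u`
  -- on a strip of finite width in `x`.
  rw [integral_integral_swap]
  · have h4 : ∀ u : ℝ, ∫ x in Ioc (-1 : ℝ) 0, (K u : ℂ) * (e x * relDensity β d (Real.logb β u - x)) =
        ((K u : ℂ) * e (Real.logb β u)) * densityFourier β d (-k) := by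
      intro u
      rw [integral_const_mul, ← intervalIntegral.integral_of_le (by norm_num),
        integral_exp_mul_relDensity hβ hd, ← mul_assoc]
    simp_rw [h4]
    rw [integral_mul_const, ← integral_exp_mul_rpow_imagPt β hD]
    congr 1
    refine setIntegral_congr_fun measurableSet_Ioi fun u hu => ?_
    rw [cpow_imagPt hβ hu]
  · have h5 : Integrable (fun p : ℝ × ℝ => C * K p.2)
        ((volume.restrict (Ioc (-1 : ℝ) 0)).prod (volume.restrict (Ioi 0))) :=
      (integrable_const C).mul_prod hK
    refine h5.mono' ?_ ?_
    · have h6 := measurable_relDensity hβ hd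
      have h7 := measurable_logb β
      refine Measurable.aestronglyMeasurable ?_
      simp only [Function.uncurry_def, K, e]
      fun_prop
    · have h8 : ∀ᵐ p : ℝ × ℝ ∂((volume.restrict (Ioc (-1 : ℝ) 0)).prod (volume.restrict (Ioi 0))),
          p.2 ∈ Ioi (0 : ℝ) := by
        rw [Measure.prod_restrict]
        refine (ae_restrict_mem (measurableSet_Ioc.prod measurableSet_Ioi)).mono fun p hp => hp.2
      refine h8.mono fun p hp => ?_
      have hK0 : 0 ≤ K p.2 := mul_nonneg (Real.exp_pos _).le (Real.rpow_nonneg (le_of_lt hp) _)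
      rw [Function.uncurry_def, norm_mul, norm_mul, he, one_mul, Complex.norm_real, Complex.norm_real,
        Real.norm_of_nonneg hK0, Real.norm_of_nonneg (relDensity_nonneg hβ hd _), mul_comm]
      exact mul_le_mul_of_nonneg_right (hΨ _) hK0

end

/-! ### Poles, residues and special values for the base `β^k`. -/

section

open Set

variable {β : ℝ} {d : Finset ℝ}

lemma polePt_add (β : ℝ) (d : Finset ℝ) (j : ℕ) (k : ℤ) :
    polePt β d j k + ((j : ℂ) - dimExp β d) = imagPt β k := by
  rw [polePt, imagPt]; ring

lemma polePt_re (β : ℝ) (d : Finset ℝ) (j : ℕ) (k : ℤ) : (polePt β d j k).re = dimExp β d - j := by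
  simp [polePt, Complex.div_re]

lemma cpow_neg_imagPt (hβ : 1 < β) (k : ℤ) : (β : ℂ) ^ (-imagPt β k) = 1 := by
  have hβ0 : 0 < β := by linarith
  rw [Complex.cpow_neg, cpow_imagPt hβ hβ0, Real.logb_self_eq_one hβ, ← Complex.exp_neg]
  refine Complex.exp_eq_one_iff.mpr ⟨k, ?_⟩
  push_cast
  ring

lemma exists_eq_imagPt (hβ : 1 < β) {w : ℂ} (hw : 1 - (β : ℂ) ^ (-w) = 0) :
    ∃ k : ℤ, w = imagPt β k := by
  have hβ0 : 0 < β := by linarith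
  have hlog : (Real.log β : ℂ) ≠ 0 := by exact_mod_cast (Real.log_pos hβ).ne'
  have h := (sub_eq_zero.mp hw).symm
  rw [Complex.cpow_def_of_ne_zero (by exact_mod_cast hβ0.ne'), ← Complex.ofReal_log hβ0.le,
    Complex.exp_eq_one_iff] at h
  obtain ⟨n, hn⟩ := h
  refine ⟨n, ?_⟩
  rw [imagPt, eq_neg_iff_add_eq_zero, ← mul_right_inj' hlog, mul_add, mul_div_cancel₀ _ hlog]
  linear_combination -hn

/-- The `j`-th singular term of the continued Mellin transform. -/
def singTerm (β : ℝ) (d : Finset ℝ) (j : ℕ) (s : ℂ) : ℂ :=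
  (coeffC β d j : ℂ) * (mellin (densityPeriod β d) (s + ((j : ℂ) - dimExp β d)) /
      (1 - (β : ℂ) ^ (-(s + ((j : ℂ) - dimExp β d)))))

lemma differentiable_den (hβ : 1 < β) (a : ℂ) :
    Differentiable ℂ fun s : ℂ => 1 - (β : ℂ) ^ (-(s + a)) := by
  have hβ0 : (β : ℂ) ≠ 0 := by exact_mod_cast (by linarith : β ≠ 0)
  intro s
  refine DifferentiableAt.const_sub ?_ _
  exact DifferentiableAt.const_cpow (by fun_prop) (Or.inl hβ0)

lemma differentiable_num (hβ : 1 < β) (hd : IsDigitSet d) (a : ℂ) :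
    Differentiable ℂ fun s : ℂ => mellin (densityPeriod β d) (s + a) :=
  (differentiable_mellin_densityPeriod hβ hd).comp (by fun_prop)

lemma meromorphicAt_singTerm (hβ : 1 < β) (hd : IsDigitSet d) (j : ℕ) (s : ℂ) :
    MeromorphicAt (singTerm β d j) s :=
  (MeromorphicAt.const _ _).mul (((differentiable_num hβ hd _).analyticAt s).meromorphicAt.div
    ((differentiable_den hβ _).analyticAt s).meromorphicAt)

lemma analyticAt_singTerm (hβ : 1 < β) (hd : IsDigitSet d) {j : ℕ} {s : ℂ}
    (hs : ∀ k : ℤ, s ≠ polePt β d j k) : AnalyticAt ℂ (singTerm β d j) s := by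
  refine analyticAt_const.mul (((differentiable_num hβ hd _).analyticAt s).div
    ((differentiable_den hβ _).analyticAt s) fun h => ?_)
  obtain ⟨k, hk⟩ := exists_eq_imagPt hβ h
  rw [← polePt_add β d j] at hk
  exact hs k (add_right_cancel hk)

/-- The denominator has derivative `log β` at its zero, which cancels the `log β` in the transform
of a period. -/
lemma tendsto_sub_mul_singTerm (hβ : 1 < β) (hd : IsDigitSet d) (j : ℕ) (k : ℤ) :
    Tendsto (fun s => (s - polePt β d j k) * singTerm β d j s) (𝓝[≠] (polePt β d j k))
      (𝓝 ((coeffC β d j : ℂ) *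
        (Complex.Gamma (1 + dimExp β d + imagPt β k) * densityFourier β d (-k)))) := by
  set p := polePt β d j k with hp
  have hlog : (Real.log β : ℂ) ≠ 0 := by exact_mod_cast (Real.log_pos hβ).ne'
  have hβ0 : 0 < β := by linarith
  have hβ0' : (β : ℂ) ≠ 0 := by exact_mod_cast hβ0.ne'
  let q : ℂ → ℂ := fun s => 1 - (β : ℂ) ^ (-(s + ((j : ℂ) - dimExp β d)))
  have hq0 : q p = 0 := by simp only [q, hp, polePt_add, cpow_neg_imagPt hβ, sub_self]
  have hq : HasDerivAt q (Real.log β) p := by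
    have h1 : HasDerivAt (fun s : ℂ => -(s + ((j : ℂ) - dimExp β d))) (-1) p :=
      ((hasDerivAt_id p).add_const _).neg
    have h2 := (h1.const_cpow (c := (β : ℂ)) (Or.inl hβ0')).const_sub 1
    have h3 : -((β : ℂ) ^ (-(p + ((j : ℂ) - dimExp β d))) * Complex.log β * -1) = Real.log β := by
      rw [hp, polePt_add, cpow_neg_imagPt hβ, Complex.ofReal_log hβ0.le]
      ring
    rwa [h3] at h2
  have h1 := (hasDerivAt_iff_tendsto_slope.mp hq).inv₀ hlog
  have h2 : Tendsto (fun s : ℂ => mellin (densityPeriod β d) (s + ((j : ℂ) - dimExp β d))) (𝓝[≠] p)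
      (𝓝 (mellin (densityPeriod β d) (imagPt β k))) := by
    rw [← polePt_add β d j k]
    exact ((differentiable_num hβ hd _).continuous.tendsto p).mono_left nhdsWithin_le_nhds
  have h3 := (h2.mul h1).const_mul (coeffC β d j : ℂ)
  rw [mellin_densityPeriod_imagPt hβ hd, mul_comm (Real.log β : ℂ), mul_inv_cancel_right₀ hlog] at h3
  refine h3.congr fun s => ?_
  rw [slope_def_field, hq0, sub_zero, inv_div, singTerm]
  simp only [q]
  ring

lemma mellinCont_eq (J : ℕ) (s : ℂ) : mellinCont β d J s =
    mellin (mellinRem β d J) s + ∑ j ∈ Finset.range J, singTerm β d j s := rfl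

lemma analyticAt_mellin_mellinRem (hβ : 1 < β) (hd : IsDigitSet d) {J : ℕ} {s : ℂ}
    (hs : dimExp β d - J < s.re) : AnalyticAt ℂ (mellin (mellinRem β d J)) s := by
  have hU : IsOpen {s : ℂ | dimExp β d - J < s.re} :=
    isOpen_lt continuous_const Complex.continuous_re
  have : DifferentiableOn ℂ (mellin (mellinRem β d J)) {s : ℂ | dimExp β d - J < s.re} :=
    fun s hs => (differentiableAt_mellin_mellinRem hβ hd hs).differentiableWithinAt
  exact this.analyticAt (hU.mem_nhds hs)

lemma meromorphicAt_mellinCont (hβ : 1 < β) (hd : IsDigitSet d) {J : ℕ} {s : ℂ}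
    (hs : dimExp β d - J < s.re) : MeromorphicAt (mellinCont β d J) s :=
  (analyticAt_mellin_mellinRem hβ hd hs).meromorphicAt.add
    (MeromorphicAt.fun_sum fun j _ => meromorphicAt_singTerm hβ hd j s)

lemma analyticAt_mellinCont (hβ : 1 < β) (hd : IsDigitSet d) {J : ℕ} {s : ℂ}
    (hs : dimExp β d - J < s.re) (hp : ∀ (j : ℕ) (k : ℤ), s ≠ polePt β d j k) :
    AnalyticAt ℂ (mellinCont β d J) s :=
  (analyticAt_mellin_mellinRem hβ hd hs).add
    (Finset.analyticAt_fun_sum _ fun j _ => analyticAt_singTerm hβ hd (hp j))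

lemma tendsto_sub_mul_mellinCont (hβ : 1 < β) (hd : IsDigitSet d) {J j : ℕ} (hj : j < J) (k : ℤ) :
    Tendsto (fun s => (s - polePt β d j k) * mellinCont β d J s) (𝓝[≠] (polePt β d j k))
      (𝓝 ((coeffC β d j : ℂ) *
        (Complex.Gamma (1 + dimExp β d + imagPt β k) * densityFourier β d (-k)))) := by
  set p := polePt β d j k with hp
  have hre : dimExp β d - J < p.re := by
    rw [hp, polePt_re]
    have : (j : ℝ) < J := by exact_mod_cast hj
    linarith
  -- The singular terms with index `i ≠ j` have their poles on the other vertical lines `Re s = D -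
  -- i`.
  have h1 : AnalyticAt ℂ (fun s => mellin (mellinRem β d J) s +
      ∑ i ∈ (Finset.range J).erase j, singTerm β d i s) p := by
    refine (analyticAt_mellin_mellinRem hβ hd hre).add
      (Finset.analyticAt_fun_sum _ fun i hi => analyticAt_singTerm hβ hd fun l hl => ?_)
    have h2 := congrArg Complex.re hl
    rw [hp, polePt_re, polePt_re] at h2
    have h3 : (i : ℝ) = j := by linarith
    exact (Finset.mem_erase.mp hi).1 (by exact_mod_cast h3)
  have h2 : Tendsto (fun s : ℂ => s - p) (𝓝[≠] p) (𝓝 0) := by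
    have : Continuous fun s : ℂ => s - p := by fun_prop
    simpa using (this.tendsto p).mono_left nhdsWithin_le_nhds
  have h3 := (tendsto_sub_mul_singTerm hβ hd j k).add
    (h2.mul (h1.continuousAt.tendsto.mono_left nhdsWithin_le_nhds))
  rw [zero_mul, add_zero] at h3
  refine h3.congr fun s => ?_
  rw [mellinCont_eq, ← Finset.add_sum_erase _ _ (Finset.mem_range.mpr hj)]
  ring

/-- The continuation of the zeta function to `Re s > D - J`. -/
def zetaLocal (β : ℝ) (d : Finset ℝ) (J : ℕ) (s : ℂ) : ℂ :=
  (Complex.Gamma s)⁻¹ * mellinCont β d J s - (Complex.Gamma (s + 1))⁻¹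

/-- The continuation of the zeta function, up to its values at removable singularities. -/
def zetaGlue (β : ℝ) (d : Finset ℝ) (s : ℂ) : ℂ :=
  zetaLocal β d (⌊dimExp β d - s.re⌋₊ + 1) s

lemma zetaGlue_eq (hβ : 1 < β) (hd : IsDigitSet d) {J : ℕ} {s : ℂ}
    (hs : dimExp β d - J < s.re) : zetaGlue β d s = zetaLocal β d J s := by
  have h1 : dimExp β d - (⌊dimExp β d - s.re⌋₊ + 1 : ℕ) < s.re := by
    have := Nat.lt_floor_add_one (dimExp β d - s.re)
    push_cast
    linarith
  rw [zetaGlue, zetaLocal, zetaLocal, ← mellinCont_eq_of_le hβ hd (le_max_left _ J) h1,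
    ← mellinCont_eq_of_le hβ hd (le_max_right (⌊dimExp β d - s.re⌋₊ + 1) J) hs]

lemma zetaGlue_eventuallyEq (hβ : 1 < β) (hd : IsDigitSet d) {J : ℕ} {s : ℂ}
    (hs : dimExp β d - J < s.re) : zetaGlue β d =ᶠ[𝓝 s] zetaLocal β d J := by
  have hU : IsOpen {s : ℂ | dimExp β d - J < s.re} :=
    isOpen_lt continuous_const Complex.continuous_re
  filter_upwards [hU.mem_nhds hs] with z hz
  exact zetaGlue_eq hβ hd hz

lemma zetaGlue_eq_zeta (hβ : 1 < β) (hd : IsDigitSet d) {s : ℂ} (hs : dimExp β d < s.re) :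
    zetaGlue β d s = zeta (fun k => β ^ k) d s := by
  have hs0 : 0 < s.re := (dimExp_pos hβ hd).trans hs
  have hs0' : s ≠ 0 := by rintro rfl; simp at hs0
  have hΓ := Complex.Gamma_ne_zero_of_re_pos hs0
  rw [zetaGlue_eq hβ hd (J := 0) (by simpa using hs), zetaLocal, mellinCont_zero hβ hd hs,
    Complex.Gamma_add_one s hs0']
  field_simp
  ring

lemma analyticAt_inv_Gamma (s : ℂ) : AnalyticAt ℂ (fun s => (Complex.Gamma s)⁻¹) s :=
  Complex.differentiable_one_div_Gamma.analyticAt s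

lemma analyticAt_inv_Gamma_add_one (s : ℂ) :
    AnalyticAt ℂ (fun s => (Complex.Gamma (s + 1))⁻¹) s :=
  (Complex.differentiable_one_div_Gamma.comp
    (differentiable_id.add_const (1 : ℂ))).analyticAt s

lemma exists_lt_re (β : ℝ) (d : Finset ℝ) (s : ℂ) : ∃ J : ℕ, dimExp β d - J < s.re := by
  obtain ⟨J, hJ⟩ := exists_nat_gt (dimExp β d - s.re)
  exact ⟨J, by linarith⟩

lemma meromorphicAt_zetaGlue (hβ : 1 < β) (hd : IsDigitSet d) (s : ℂ) :
    MeromorphicAt (zetaGlue β d) s := by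
  obtain ⟨J, hJ⟩ := exists_lt_re β d s
  refine MeromorphicAt.congr ?_ ((zetaGlue_eventuallyEq hβ hd hJ).symm.filter_mono nhdsWithin_le_nhds)
  exact ((analyticAt_inv_Gamma s).meromorphicAt.mul (meromorphicAt_mellinCont hβ hd hJ)).sub
    (analyticAt_inv_Gamma_add_one s).meromorphicAt

lemma analyticAt_zetaGlue (hβ : 1 < β) (hd : IsDigitSet d) {s : ℂ}
    (hp : ∀ (j : ℕ) (k : ℤ), s ≠ polePt β d j k) : AnalyticAt ℂ (zetaGlue β d) s := by
  obtain ⟨J, hJ⟩ := exists_lt_re β d s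
  refine AnalyticAt.congr ?_ (zetaGlue_eventuallyEq hβ hd hJ).symm
  exact ((analyticAt_inv_Gamma s).mul (analyticAt_mellinCont hβ hd hJ hp)).sub
    (analyticAt_inv_Gamma_add_one s)

lemma tendsto_sub_mul_zetaGlue (hβ : 1 < β) (hd : IsDigitSet d) (j : ℕ) (k : ℤ) :
    Tendsto (fun s => (s - polePt β d j k) * zetaGlue β d s) (𝓝[≠] (polePt β d j k))
      (𝓝 (poleRes β d j k)) := by
  set p := polePt β d j k with hp
  have hre : dimExp β d - (j + 1 : ℕ) < p.re := by
    rw [hp, polePt_re]; push_cast; linarith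
  have h1 := ((analyticAt_inv_Gamma p).continuousAt.tendsto.mono_left nhdsWithin_le_nhds).mul
    (tendsto_sub_mul_mellinCont hβ hd (Nat.lt_succ_self j) k)
  have h2 : Tendsto (fun s : ℂ => s - p) (𝓝[≠] p) (𝓝 0) := by
    have : Continuous fun s : ℂ => s - p := by fun_prop
    simpa using (this.tendsto p).mono_left nhdsWithin_le_nhds
  have h3 := h1.sub (h2.mul
    ((analyticAt_inv_Gamma_add_one p).continuousAt.tendsto.mono_left nhdsWithin_le_nhds))
  rw [zero_mul, sub_zero] at h3
  have h4 : (Complex.Gamma p)⁻¹ * ((coeffC β d j : ℂ) *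
      (Complex.Gamma (1 + dimExp β d + imagPt β k) * densityFourier β d (-k))) = poleRes β d j k := by
    rw [poleRes, imagPt, ← sub_eq_add_neg, ← hp]
    ring
  rw [h4] at h3
  refine h3.congr' ?_
  filter_upwards [(zetaGlue_eventuallyEq hβ hd hre).filter_mono nhdsWithin_le_nhds] with s hs
  rw [hs, zetaLocal]
  ring

lemma inv_Gamma_add_one_neg (n : ℕ) :
    (Complex.Gamma (-(n : ℂ) + 1))⁻¹ = if n = 0 then 1 else 0 := by
  rcases Nat.eq_zero_or_pos n with rfl | hn
  · simp
  · obtain ⟨m, rfl⟩ := Nat.exists_eq_succ_of_ne_zero hn.ne'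
    have : -((m + 1 : ℕ) : ℂ) + 1 = -(m : ℂ) := by push_cast; ring
    rw [Nat.succ_eq_add_one, this, Complex.Gamma_neg_nat_eq_zero, inv_zero, if_neg (by omega)]

/-- The derivative of `1/Γ` at its zero `-n`, by induction on `n` from `1/Γ(s) = s / Γ(s+1)`. -/
lemma tendsto_inv_Gamma_div (n : ℕ) :
    Tendsto (fun s : ℂ => (Complex.Gamma s)⁻¹ / (s + n)) (𝓝[≠] (-(n : ℂ)))
      (𝓝 ((-1) ^ n * (n.factorial : ℂ))) := by
  induction n with
  | zero =>
    have h := (analyticAt_inv_Gamma_add_one 0).continuousAt.tendsto.mono_left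
      (nhdsWithin_le_nhds (s := {0}ᶜ))
    simp only [zero_add, Complex.Gamma_one, inv_one] at h
    simp only [Nat.cast_zero, neg_zero, pow_zero, Nat.factorial_zero, Nat.cast_one, mul_one,
      add_zero]
    refine h.congr' ?_
    filter_upwards [self_mem_nhdsWithin] with s hs
    have hs' : s ≠ 0 := hs
    rw [Complex.one_div_Gamma_eq_self_mul_one_div_Gamma_add_one s]
    field_simp
  | succ n ih =>
    have h1 : Tendsto (fun s : ℂ => s + 1) (𝓝[≠] (-((n + 1 : ℕ) : ℂ))) (𝓝[≠] (-(n : ℂ))) := by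
      have h0 : Tendsto (fun s : ℂ => s + 1) (𝓝 (-((n + 1 : ℕ) : ℂ))) (𝓝 (-(n : ℂ))) := by
        have : Continuous fun s : ℂ => s + 1 := by fun_prop
        have h := this.tendsto (-((n + 1 : ℕ) : ℂ))
        rwa [show -((n + 1 : ℕ) : ℂ) + 1 = -(n : ℂ) by push_cast; ring] at h
      refine tendsto_nhdsWithin_iff.mpr ⟨h0.mono_left nhdsWithin_le_nhds, ?_⟩
      filter_upwards [self_mem_nhdsWithin] with s hs h
      refine hs ?_
      have h' : s + 1 = -(n : ℂ) := h
      have : s = -((n + 1 : ℕ) : ℂ) := by push_cast; linear_combination h'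
      exact this
    have h2 : Tendsto (fun s : ℂ => s) (𝓝[≠] (-((n + 1 : ℕ) : ℂ))) (𝓝 (-((n + 1 : ℕ) : ℂ))) :=
      tendsto_id.mono_left nhdsWithin_le_nhds
    have h3 := h2.mul (ih.comp h1)
    have h4 : -((n + 1 : ℕ) : ℂ) * ((-1) ^ n * (n.factorial : ℂ)) =
        (-1) ^ (n + 1) * ((n + 1).factorial : ℂ) := by
      rw [Nat.factorial_succ, pow_succ]; push_cast; ring
    rw [h4] at h3
    refine h3.congr fun s => ?_
    rw [Function.comp_apply, Complex.one_div_Gamma_eq_self_mul_one_div_Gamma_add_one s]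
    push_cast
    rw [add_assoc s, add_comm (1 : ℂ)]
    ring

/-- If `-n` is some `p(j,k)`, then `k = 0` and `j = n + D`, and the simple zero of `1/Γ` cancels the
simple pole. Otherwise `n + D` is not an integer and `1/Γ` kills the first term. The term `1/Γ(s+1)`
is `1` at `s = 0` and `0` at the other `-n`. -/
lemma tendsto_zetaGlue_neg_nat (hβ : 1 < β) (hd : IsDigitSet d) (n : ℕ) :
    Tendsto (zetaGlue β d) (𝓝[≠] (-(n : ℂ)))
      (𝓝 ((-1) ^ n * (n.factorial : ℂ) * (coeffCReal β d (n + dimExp β d) : ℂ) *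
        Complex.Gamma (1 + (dimExp β d : ℂ)) * densityFourier β d 0 - (if n = 0 then 1 else 0))) := by
  obtain ⟨J, hJ⟩ := exists_lt_re β d (-(n : ℂ))
  have hJ0 := hJ
  have hD := dimExp_pos hβ hd
  have hΓ1 := (analyticAt_inv_Gamma_add_one (-(n : ℂ))).continuousAt.tendsto.mono_left
    (nhdsWithin_le_nhds (s := {-(n : ℂ)}ᶜ))
  rw [inv_Gamma_add_one_neg] at hΓ1
  by_cases hp : ∃ (j : ℕ) (k : ℤ), -(n : ℂ) = polePt β d j k
  · obtain ⟨j, k, hjk⟩ := hp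
    have hre := congrArg Complex.re hjk
    rw [polePt_re] at hre
    simp only [Complex.neg_re, Complex.natCast_re] at hre hJ
    have hj : (n : ℝ) + dimExp β d = j := by linarith
    have hk : imagPt β k = 0 := by
      rw [← polePt_add β d j, ← hjk]
      have : (dimExp β d : ℂ) = j - n := by
        rw [show dimExp β d = (j : ℝ) - n by linarith]; push_cast; ring
      rw [this]; ring
    have hk0 : k = 0 := by
      have hlog : (Real.log β : ℂ) ≠ 0 := by exact_mod_cast (Real.log_pos hβ).ne'
      rw [imagPt, neg_eq_zero, div_eq_zero_iff, or_iff_left hlog] at hk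
      simpa [Real.pi_ne_zero] using hk
    subst hk0
    have hjJ : j < J := by
      have : (j : ℝ) < J := by linarith
      exact_mod_cast this
    have h1 := tendsto_sub_mul_mellinCont hβ hd hjJ 0
    rw [← hjk, hk, add_zero, neg_zero] at h1
    have hc : coeffCReal β d (n + dimExp β d) = coeffC β d j := by
      rw [coeffCReal, hj, Nat.floor_natCast, if_pos rfl]
    rw [hc]
    have h2 := ((tendsto_inv_Gamma_div n).mul h1).sub hΓ1
    have h3 : (-1) ^ n * (n.factorial : ℂ) * ((coeffC β d j : ℂ) *
        (Complex.Gamma (1 + dimExp β d) * densityFourier β d 0)) =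
        (-1) ^ n * (n.factorial : ℂ) * (coeffC β d j : ℂ) *
        Complex.Gamma (1 + (dimExp β d : ℂ)) * densityFourier β d 0 := by ring
    rw [h3] at h2
    refine h2.congr' ?_
    filter_upwards [(zetaGlue_eventuallyEq hβ hd hJ0).filter_mono nhdsWithin_le_nhds,
      self_mem_nhdsWithin] with s hs hs'
    have hsn : s + n ≠ 0 := fun h => hs' (eq_neg_of_add_eq_zero_left h)
    rw [hs, zetaLocal, sub_neg_eq_add]
    field_simp
  · push Not at hp
    have hc : coeffCReal β d (n + dimExp β d) = 0 := by
      rw [coeffCReal, if_neg]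
      intro h
      refine hp ⌊(n : ℝ) + dimExp β d⌋₊ 0 ?_
      rw [polePt]
      have h' : (dimExp β d : ℂ) = (⌊(n : ℝ) + dimExp β d⌋₊ : ℂ) - n := by
        rw [eq_sub_iff_add_eq, add_comm]
        exact_mod_cast h
      rw [h']
      push_cast
      ring
    rw [hc, Complex.ofReal_zero, mul_zero, zero_mul, zero_mul]
    have h1 := ((analyticAt_inv_Gamma (-(n : ℂ))).continuousAt.tendsto.mul
      (analyticAt_mellinCont hβ hd hJ hp).continuousAt.tendsto).mono_left
      (nhdsWithin_le_nhds (s := {-(n : ℂ)}ᶜ))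
    rw [Complex.Gamma_neg_nat_eq_zero, inv_zero, zero_mul] at h1
    refine (h1.sub hΓ1).congr' ?_
    filter_upwards [(zetaGlue_eventuallyEq hβ hd hJ).filter_mono nhdsWithin_le_nhds] with s hs
    rw [hs, zetaLocal]

/-- Multiplication by `s - p` raises the order by one, and a finite limit means nonnegative order.
-/
lemma meromorphicOrderAt_ge_neg_one {F : ℂ → ℂ} {p r : ℂ} (hF : MeromorphicAt F p)
    (h : Tendsto (fun s => (s - p) * F s) (𝓝[≠] p) (𝓝 r)) : (-1 : ℤ) ≤ meromorphicOrderAt F p := by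
  have hid : MeromorphicAt (fun s : ℂ => s - p) p := by fun_prop
  have h1 : 0 ≤ meromorphicOrderAt ((fun s : ℂ => s - p) * F) p :=
    (tendsto_nhds_iff_meromorphicOrderAt_nonneg (hid.mul hF)).mp ⟨r, h⟩
  have h2 : meromorphicOrderAt (fun s : ℂ => s - p) p = 1 := meromorphicOrderAt_id_sub_const
  rw [meromorphicOrderAt_mul hid hF, h2] at h1
  generalize meromorphicOrderAt F p = o at h1 ⊢
  induction o using WithTop.recTopCoe with
  | top => exact le_top
  | coe n =>
    have h3 : (0 : ℤ) ≤ 1 + n := by exact_mod_cast h1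
    exact_mod_cast (by omega : (-1 : ℤ) ≤ n)

/-- The continuation for the base `(β^k)`. -/
theorem exists_isZetaContinuation_pow (hβ : 1 < β) (hd : IsDigitSet d) :
    ∃ F : ℂ → ℂ, IsZetaContinuation β (fun k => β ^ k) d univ F := by
  have hmer : MeromorphicOn (zetaGlue β d) univ := fun s _ => meromorphicAt_zetaGlue hβ hd s
  -- The explicit formula may take wrong values at removable singularities, where division by zero
  -- yields `0`. In normal form, a finite punctured limit forces analyticity with that value.
  let F := toMeromorphicNFOn (zetaGlue β d) univ
  have hNF : ∀ s, MeromorphicNFAt F s := fun s =>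
    meromorphicNFOn_toMeromorphicNFOn (zetaGlue β d) univ (mem_univ s)
  have hEq : ∀ s, zetaGlue β d =ᶠ[𝓝[≠] s] F := fun s =>
    (hmer.toMeromorphicNFOn_eq_self_on_nhdsNE (mem_univ s)).symm
  have hval : ∀ {s v}, Tendsto (zetaGlue β d) (𝓝[≠] s) (𝓝 v) → AnalyticAt ℂ F s ∧ F s = v := by
    intro s v h
    have h1 := h.congr' (hEq s)
    have h2 : AnalyticAt ℂ F s := (hNF s).meromorphicOrderAt_nonneg_iff_analyticAt.mp
      ((tendsto_nhds_iff_meromorphicOrderAt_nonneg (hNF s).meromorphicAt).mp ⟨v, h1⟩)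
    exact ⟨h2, tendsto_nhds_unique (h2.continuousAt.tendsto.mono_left nhdsWithin_le_nhds) h1⟩
  have han : ∀ s, (∀ (j : ℕ) (k : ℤ), s ≠ polePt β d j k) → AnalyticAt ℂ F s ∧ F s = zetaGlue β d s :=
    fun s hs => hval ((analyticAt_zetaGlue hβ hd hs).continuousAt.tendsto.mono_left nhdsWithin_le_nhds)
  have hres : ∀ (j : ℕ) (k : ℤ), Tendsto (fun s => (s - polePt β d j k) * F s)
      (𝓝[≠] (polePt β d j k)) (𝓝 (poleRes β d j k)) := fun j k =>
    (tendsto_sub_mul_zetaGlue hβ hd j k).congr' ((hEq _).mono fun s hs => by rw [hs])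
  refine ⟨F, fun s _ => (hNF s).meromorphicAt, fun s hs => ?_, fun s _ h => (han s h).1,
    fun s _ => ?_, fun j k _ => hres j k, fun n _ => hval (tendsto_zetaGlue_neg_nat hβ hd n)⟩
  · refine ⟨(hasSum_zetaTerm hβ hd one_pos (one_mul_pow_le β) hs).summable, ?_⟩
    rw [(han s fun j k h => ?_).2, zetaGlue_eq_zeta hβ hd hs]
    rw [h, polePt_re] at hs
    have : (0 : ℝ) ≤ j := Nat.cast_nonneg j
    linarith
  · by_cases hp : ∃ (j : ℕ) (k : ℤ), s = polePt β d j k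
    · obtain ⟨j, k, rfl⟩ := hp
      exact meromorphicOrderAt_ge_neg_one (hNF _).meromorphicAt (hres j k)
    · push Not at hp
      refine le_trans ?_ (han s hp).1.meromorphicOrderAt_nonneg
      exact_mod_cast (by norm_num : (-1 : ℤ) ≤ 0)

end

/-! ### Perturbed bases. -/

section

open Set

variable {β γ : ℝ} {d : Finset ℝ} {b : ℕ → ℝ}

lemma exists_base_bound (hβ : 1 < β)
    (hO : (fun k : ℕ => b k - β ^ k) =O[atTop] (fun k : ℕ => β ^ ((1 - γ) * (k : ℝ)))) :
    ∃ C : ℝ, 0 < C ∧ ∀ k : ℕ, |b k - β ^ k| ≤ C * β ^ ((1 - γ) * (k : ℝ)) := by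
  have hβ0 : 0 < β := by linarith
  obtain ⟨C, hC⟩ := (isBigO_nat_atTop_iff fun k h =>
    absurd h (Real.rpow_pos_of_pos hβ0 _).ne').mp hO
  refine ⟨max C 1, by positivity, fun k => ?_⟩
  have hp : 0 < β ^ ((1 - γ) * (k : ℝ)) := Real.rpow_pos_of_pos hβ0 _
  have := hC k
  rw [Real.norm_eq_abs, Real.norm_of_nonneg hp.le] at this
  exact this.trans (mul_le_mul_of_nonneg_right (le_max_left _ _) hp.le)

/-- Since `γ > 0`, `b_k` is asymptotic to `β^k`; the convergent sequence `β^k / b_k` is bounded. -/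
lemma exists_base_lower (hβ : 1 < β) (hb : ∀ k, 0 < b k) (hγ : 0 < γ)
    (hO : (fun k : ℕ => b k - β ^ k) =O[atTop] (fun k : ℕ => β ^ ((1 - γ) * (k : ℝ)))) :
    ∃ c : ℝ, 0 < c ∧ ∀ k, c * β ^ k ≤ b k := by
  have hβ0 : 0 < β := by linarith
  have h1 : (fun k : ℕ => β ^ ((1 - γ) * (k : ℝ))) =o[atTop] fun k : ℕ => β ^ k := by
    refine isLittleO_of_tendsto (fun k h => absurd h (by positivity)) ?_
    have h2 : Tendsto (fun k : ℕ => (β ^ (-γ)) ^ k) atTop (𝓝 0) :=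
      tendsto_pow_atTop_nhds_zero_of_lt_one (by positivity)
        (Real.rpow_lt_one_of_one_lt_of_neg hβ (by linarith))
    refine h2.congr fun k => ?_
    rw [← Real.rpow_natCast, ← Real.rpow_natCast, ← Real.rpow_mul hβ0.le, ← Real.rpow_sub hβ0]
    congr 1; ring
  have h2 : Tendsto (fun k => β ^ k / b k) atTop (𝓝 1) := by
    have h3 : b ~[atTop] fun k : ℕ => β ^ k := hO.trans_isLittleO h1
    have h4 := (isEquivalent_iff_tendsto_one
      (Eventually.of_forall fun k => (hb k).ne')).mp h3.symm
    exact h4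
  obtain ⟨B, hB⟩ := h2.bddAbove_range
  have hB' : ∀ k, β ^ k / b k ≤ B := fun k => hB ⟨k, rfl⟩
  have hB0 : 0 < B := lt_of_lt_of_le (div_pos (by positivity) (hb 0)) (hB' 0)
  refine ⟨B⁻¹, by positivity, fun k => ?_⟩
  have := hB' k
  rw [div_le_iff₀ (hb k)] at this
  rw [inv_mul_le_iff₀ hB0]
  exact this

/-- Mean value inequality on `[A, ∞)`; for `Re s ≥ -1` the bound `|s| t^(-Re s - 1)` on the
derivative is largest at `t = A`. -/
lemma norm_cpow_neg_sub_le {A x y : ℝ} (hA : 0 < A) (hx : A ≤ x) (hy : A ≤ y) {s : ℂ}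
    (hs : -1 ≤ s.re) :
    ‖1 / (x : ℂ) ^ s - 1 / (y : ℂ) ^ s‖ ≤ ‖s‖ * A ^ (-s.re - 1) * |x - y| := by
  have hder : ∀ t ∈ Ici A, HasDerivWithinAt (fun t : ℝ => (t : ℂ) ^ (-s))
      (-s * (t : ℂ) ^ (-s - 1)) (Ici A) t := by
    intro t ht
    have ht0 : 0 < t := hA.trans_le ht
    have h1 : HasDerivAt (fun z : ℂ => z ^ (-s)) (-s * (t : ℂ) ^ (-s - 1)) (t : ℂ) := by
      have := (hasDerivAt_id (t : ℂ)).cpow_const (c := -s) (Or.inl (by simpa using ht0))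
      simpa using this
    exact h1.comp_ofReal.hasDerivWithinAt
  have hbound : ∀ t ∈ Ici A, ‖-s * (t : ℂ) ^ (-s - 1)‖ ≤ ‖s‖ * A ^ (-s.re - 1) := by
    intro t ht
    have ht0 : 0 < t := hA.trans_le ht
    rw [norm_mul, norm_neg, Complex.norm_cpow_eq_rpow_re_of_pos ht0]
    refine mul_le_mul_of_nonneg_left ?_ (norm_nonneg _)
    simp only [Complex.sub_re, Complex.neg_re, Complex.one_re]
    exact Real.rpow_le_rpow_of_nonpos hA ht (by linarith)
  have h := (convex_Ici A).norm_image_sub_le_of_norm_hasDerivWithin_le hder hbound hy hx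
  simpa [Complex.cpow_neg] using h

/-- The difference of the zeta functions of two bases, as a series over words. -/
def zetaDiff (β : ℝ) (b : ℕ → ℝ) (d : Finset ℝ) (s : ℂ) : ℂ :=
  ∑' w : NzWord d, (1 / (w.1.val b : ℂ) ^ s - 1 / (w.1.pval β : ℂ) ^ s)

lemma zetaDiff_zero : zetaDiff β b d 0 = 0 := by
  simp [zetaDiff]

lemma zetaDiff_eq (hβ : 1 < β) (hd : IsDigitSet d) {c₀ : ℝ} (hc₀ : 0 < c₀)
    (hb : ∀ k, c₀ * β ^ k ≤ b k) {s : ℂ} (hs : dimExp β d < s.re) :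
    zetaDiff β b d s = zeta b d s - zeta (fun k => β ^ k) d s := by
  have hsum : ∀ (b : ℕ → ℝ) {c₀ : ℝ}, 0 < c₀ → (∀ k, c₀ * β ^ k ≤ b k) →
      Summable fun w : NzWord d => 1 / (w.1.val b : ℂ) ^ s := by
    intro b c₀ hc₀ hb
    refine Summable.of_norm ((summable_val_rpow hβ hd hc₀ hb hs).congr fun w => ?_)
    rw [norm_div, norm_one, Complex.norm_cpow_eq_rpow_re_of_pos (val_pos hβ hd hc₀ hb w),
      Real.rpow_neg (val_pos hβ hd hc₀ hb w).le, one_div]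
  rw [zeta, zeta, (hasSum_zetaTerm hβ hd hc₀ hb hs).tsum_eq,
    (hasSum_zetaTerm hβ hd one_pos (one_mul_pow_le β) hs).tsum_eq, zetaDiff]
  exact (hsum b hc₀ hb).tsum_sub (hsum _ one_pos (one_mul_pow_le β))

/-- Bounding each of the `deg w` errors by the largest one covers `γ = 1` uniformly; the extra
factor `deg w` is harmless later. -/
lemma exists_val_sub_le (hβ : 1 < β) (hd : IsDigitSet d) (hγ1 : γ ≤ 1)
    (hO : (fun k : ℕ => b k - β ^ k) =O[atTop] (fun k : ℕ => β ^ ((1 - γ) * (k : ℝ)))) :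
    ∃ C : ℝ, 0 < C ∧ ∀ w : Word d,
      |w.val b - w.pval β| ≤ C * (w.deg * β ^ ((1 - γ) * (w.deg : ℝ))) := by
  have hβ0 : 0 < β := by linarith
  obtain ⟨C, hC, hCb⟩ := exists_base_bound hβ hO
  obtain ⟨M, hM, hMd⟩ := hd.exists_bound
  refine ⟨M * C, by positivity, fun w => ?_⟩
  rw [Word.pval, w.val_eq_sum b le_rfl, w.val_eq_sum _ le_rfl, ← Finset.sum_sub_distrib]
  refine (Finset.abs_sum_le_sum_abs _ _).trans ?_
  have : ∀ k ∈ Finset.range w.deg, |w.1 k * b k - w.1 k * β ^ k| ≤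
      M * C * β ^ ((1 - γ) * (w.deg : ℝ)) := by
    intro k hk
    have hk' : (k : ℝ) ≤ w.deg := by exact_mod_cast (Finset.mem_range.mp hk).le
    rw [← mul_sub, abs_mul, abs_of_nonneg (hd.nonneg _ (w.2.1 k)), mul_assoc]
    refine mul_le_mul (hMd _ (w.2.1 k)) ((hCb k).trans ?_) (abs_nonneg _) hM.le
    refine mul_le_mul_of_nonneg_left ?_ hC.le
    refine Real.rpow_le_rpow_of_exponent_le hβ.le ?_
    exact mul_le_mul_of_nonneg_left hk' (by linarith)
  refine (Finset.sum_le_sum this).trans (le_of_eq ?_)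
  rw [Finset.sum_const, Finset.card_range, nsmul_eq_mul]
  ring

lemma analyticAt_zetaDiff (hβ : 1 < β) (hd : IsDigitSet d) (hb : ∀ k, 0 < b k) (hγ : 0 < γ)
    (hγ1 : γ ≤ 1)
    (hO : (fun k : ℕ => b k - β ^ k) =O[atTop] (fun k : ℕ => β ^ ((1 - γ) * (k : ℝ))))
    {s : ℂ} (hs : dimExp β d - γ < s.re) : AnalyticAt ℂ (zetaDiff β b d) s := by
  have hβ0 : 0 < β := by linarith
  have hD := dimExp_pos hβ hd
  obtain ⟨c₀, hc₀, hbc⟩ := exists_base_lower hβ hb hγ hO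
  obtain ⟨c₁, hc₁, h1⟩ := exists_le_val hβ hd hc₀ hbc
  obtain ⟨c₂, hc₂, h2⟩ := exists_le_pval hβ hd
  obtain ⟨C, hC, hdiff⟩ := exists_val_sub_le hβ hd hγ1 hO
  obtain ⟨c, hc, hc1, hcc₁, hcc₂⟩ : ∃ c : ℝ, 0 < c ∧ c ≤ 1 ∧ c ≤ c₁ ∧ c ≤ c₂ :=
    ⟨min 1 (min c₁ c₂), by positivity, min_le_left _ _, (min_le_right _ _).trans (min_le_left _ _),
      (min_le_right _ _).trans (min_le_right _ _)⟩
  obtain ⟨σ, hσ, hσs⟩ := exists_between hs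
  obtain ⟨R, hR⟩ := exists_gt ‖s‖
  have hR0 : 0 < R := (norm_nonneg s).trans_lt hR
  let U : Set ℂ := {z | σ < z.re} ∩ {z | ‖z‖ < R}
  have hU : IsOpen U := (isOpen_lt continuous_const Complex.continuous_re).inter
    (isOpen_lt continuous_norm continuous_const)
  -- A majorant uniform on `U`: since `c ≤ 1` and `Re z ≤ ‖z‖ < R`, the power of `c` is at most
  -- `c^(-R-1)`. Weighted by `|d|^n` it is a constant times `n β^((D - σ - γ) n)`, summable because
  -- `σ > D - γ`.
  let g : ℕ → ℝ := fun n => R * (c ^ (-R - 1) * (β ^ n) ^ (-σ - 1)) *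
    (C * (n * β ^ ((1 - γ) * (n : ℝ))))
  have hg : Summable fun w : NzWord d => g w.1.deg := by
    refine (Word.summable_of_deg (d := d) (g := g) (fun n => by positivity) ?_).comp_injective
      Subtype.val_injective
    have hr : ‖β ^ (dimExp β d - σ - γ)‖ < 1 := by
      rw [Real.norm_of_nonneg (by positivity)]
      exact Real.rpow_lt_one_of_one_lt_of_neg hβ (by linarith)
    refine ((summable_pow_mul_geometric_of_norm_lt_one 1 hr).mul_left
      (R * c ^ (-R - 1) * C)).congr fun n => ?_
    have e : (β ^ (dimExp β d - σ - γ)) ^ n =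
        (d.card : ℝ) ^ n * ((β ^ n) ^ (-σ - 1) * β ^ ((1 - γ) * (n : ℝ))) := by
      rw [← rpow_dimExp hβ hd, ← Real.rpow_natCast, ← Real.rpow_natCast, ← Real.rpow_natCast,
        ← Real.rpow_mul hβ0.le, ← Real.rpow_mul hβ0.le, ← Real.rpow_mul hβ0.le,
        ← Real.rpow_add hβ0, ← Real.rpow_add hβ0]
      congr 1; ring
    simp only [g]
    rw [e, pow_one]
    ring
  have hdiffble : DifferentiableOn ℂ (zetaDiff β b d) U := by
    refine Complex.differentiableOn_tsum_of_summable_norm hg (fun w => ?_) hU fun w z hz => ?_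
    · have hx := val_pos hβ hd hc₀ hbc w
      have hy := val_pos hβ hd one_pos (one_mul_pow_le β) w
      have key : ∀ x : ℝ, 0 < x → Differentiable ℂ fun z : ℂ => 1 / (x : ℂ) ^ z := by
        intro x hx z
        have hx' : (x : ℂ) ≠ 0 := by exact_mod_cast hx.ne'
        refine (differentiableAt_const _).div (differentiableAt_id.const_cpow (Or.inl hx')) ?_
        simp [Complex.cpow_eq_zero_iff, hx']
      exact ((key _ hx).sub (key _ hy)).differentiableOn
    · have hβn : 0 < β ^ w.1.deg := by positivity
      have hzR : z.re ≤ R := (Complex.re_le_norm z).trans (le_of_lt hz.2)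
      have hzσ : σ < z.re := hz.1
      refine (norm_cpow_neg_sub_le (A := c * β ^ w.1.deg) (by positivity)
        ((mul_le_mul_of_nonneg_right hcc₁ hβn.le).trans (h1 w))
        ((mul_le_mul_of_nonneg_right hcc₂ hβn.le).trans (h2 w)) (by linarith)).trans ?_
      have h3 : (c * β ^ w.1.deg) ^ (-z.re - 1) ≤ c ^ (-R - 1) * (β ^ w.1.deg) ^ (-σ - 1) := by
        rw [Real.mul_rpow hc.le hβn.le]
        refine mul_le_mul (Real.rpow_le_rpow_of_exponent_ge hc hc1 (by linarith))
          (Real.rpow_le_rpow_of_exponent_le (one_le_pow₀ hβ.le) (by linarith))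
          (by positivity) (by positivity)
      exact mul_le_mul (mul_le_mul (le_of_lt hz.2) h3 (by positivity) hR0.le) (hdiff w.1)
        (abs_nonneg _) (by positivity)
  exact hdiffble.analyticAt (hU.mem_nhds ⟨hσs, hR⟩)

/-- Passing from the base `(β^k)` to a perturbed base. -/
theorem IsZetaContinuation.perturb (hβ : 1 < β) (hd : IsDigitSet d) (hb : ∀ k, 0 < b k)
    (hγ : 0 < γ) (hγ1 : γ ≤ 1)
    (hO : (fun k : ℕ => b k - β ^ k) =O[atTop] (fun k : ℕ => β ^ ((1 - γ) * (k : ℝ))))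
    {F : ℂ → ℂ} (hF : IsZetaContinuation β (fun k => β ^ k) d univ F) :
    IsZetaContinuation β b d {s : ℂ | dimExp β d - γ < s.re} (F + zetaDiff β b d) := by
  have hD := dimExp_pos hβ hd
  obtain ⟨c₀, hc₀, hbc⟩ := exists_base_lower hβ hb hγ hO
  have hG : ∀ {s : ℂ}, dimExp β d - γ < s.re → AnalyticAt ℂ (zetaDiff β b d) s :=
    fun hs => analyticAt_zetaDiff hβ hd hb hγ hγ1 hO hs
  have hmer : MeromorphicOn (F + zetaDiff β b d) {s : ℂ | dimExp β d - γ < s.re} :=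
    fun s hs => (hF.meromorphic s (mem_univ s)).add (hG hs).meromorphicAt
  have hres : ∀ (j : ℕ) (k : ℤ), polePt β d j k ∈ {s : ℂ | dimExp β d - γ < s.re} →
      Tendsto (fun s => (s - polePt β d j k) * (F + zetaDiff β b d) s) (𝓝[≠] (polePt β d j k))
      (𝓝 (poleRes β d j k)) := by
    intro j k hp
    have h1 := hF.residue j k (mem_univ _)
    have h2 : Tendsto (fun s : ℂ => s - polePt β d j k) (𝓝[≠] (polePt β d j k)) (𝓝 0) := by
      have : Continuous fun s : ℂ => s - polePt β d j k := by fun_prop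
      simpa using (this.tendsto (polePt β d j k)).mono_left nhdsWithin_le_nhds
    have h3 := h1.add (h2.mul ((hG hp).continuousAt.tendsto.mono_left nhdsWithin_le_nhds))
    rw [zero_mul, add_zero] at h3
    refine h3.congr fun s => ?_
    rw [Pi.add_apply]; ring
  have han : ∀ s ∈ {s : ℂ | dimExp β d - γ < s.re}, (∀ (j : ℕ) (k : ℤ), s ≠ polePt β d j k) →
      AnalyticAt ℂ (F + zetaDiff β b d) s :=
    fun s hs hp => (hF.analytic s (mem_univ s) hp).add (hG hs)
  refine ⟨hmer, fun s hs => ?_, han, fun s hs => ?_, hres, fun n hn => ?_⟩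
  · refine ⟨(hasSum_zetaTerm hβ hd hc₀ hbc hs).summable, ?_⟩
    rw [Pi.add_apply, (hF.eq_zeta s hs).2, zetaDiff_eq hβ hd hc₀ hbc hs]
    ring
  · by_cases hp : ∃ (j : ℕ) (k : ℤ), s = polePt β d j k
    · obtain ⟨j, k, rfl⟩ := hp
      exact meromorphicOrderAt_ge_neg_one (hmer _ hs) (hres j k hs)
    · push Not at hp
      refine le_trans ?_ (han s hs hp).meromorphicOrderAt_nonneg
      exact_mod_cast (by norm_num : (-1 : ℤ) ≤ 0)
  -- Membership of `-n` in the half-plane gives `n < γ - D < 1`; at `0` every term of the difference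
  -- series is `1 - 1`.
  · have hn0 : n = 0 := by
      have h1 : dimExp β d - γ < -(n : ℝ) := by simpa using hn
      have h2 : (n : ℝ) < 1 := by linarith
      have h3 : n < 1 := by exact_mod_cast h2
      omega
    obtain ⟨h1, h2⟩ := hF.value n (mem_univ _)
    refine ⟨h1.add (hG hn), ?_⟩
    subst hn0
    have hz : zetaDiff β b d (-((0 : ℕ) : ℂ)) = 0 := by rw [Nat.cast_zero, neg_zero, zetaDiff_zero]
    rw [Pi.add_apply, h2, hz, add_zero]

end

end NumSys
end

theorem theorem1p3 (β : ℝ) (hβ : 1 < β) (d : Finset ℝ) (hd0 : (0 : ℝ) ∈ d)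
    (hdnn : ∀ δ ∈ d, 0 ≤ δ) (hdcard : 2 ≤ d.card) :
    (∀ (b : ℕ → ℝ) (γ : ℝ), (∀ k, 0 < b k) → 0 < γ → γ ≤ 1 →
      ((fun k : ℕ => b k - β ^ k) =O[atTop] (fun k : ℕ => β ^ ((1 - γ) * (k : ℝ)))) →
      ∃ F : ℂ → ℂ,
        NumSys.IsZetaContinuation β b d {s : ℂ | NumSys.dimExp β d - γ < s.re} F) ∧
    (∃ F : ℂ → ℂ, NumSys.IsZetaContinuation β (fun k => β ^ k) d Set.univ F) := by
  have hd : NumSys.IsDigitSet d := ⟨hd0, hdnn, hdcard⟩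
  obtain ⟨F, hF⟩ := NumSys.exists_isZetaContinuation_pow hβ hd
  exact ⟨fun b γ hb hγ hγ1 hO => ⟨_, hF.perturb hβ hd hb hγ hγ1 hO⟩, F, hF⟩
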